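/- Let $d,N\ge 1$ be integers and let $\Omega\subset\mathbb{R}^d$ be a non-empty, bounded, open set. Write $|E|$ for the Lebesgue measure of a measurable set $E\subset\mathbb R^d$, $B_1$ for the unit ball of $\mathbb R^d$, and, for $u\in L^1(\mathbb{R}^d)$, $$|Du|(\mathbb{R}^d)=\sup\Big\{\int_{\mathbb{R}^d}u\,\operatorname{div}\varphi\,dx:\ \varphi\in C^1_c(\mathbb{R}^d;\mathbb{R}^d),\ |\varphi|\le 1\Big\};$$ the perimeter $P(E)$ is given by the same formula with $u=\chi_E$. Let $\mathbb{R}^N_+=[0,\infty)^N$ and let $\Phi\colon\mathbb{R}^N_+\to[0,\infty)$ be * coercive: for some $\delta>0$, $\Phi(v)\ge\delta\sum_{i=1}^N v_i$ for all $v\in\mathbb{R}^N_+$; * strictly increasing: $\Phi(v)<\Phi(w)$ whenever $v,w\in\mathbb{R}^N_+$, $v_i\le w_i$ for all $i$, and $v_i<w_i$ for some $i$. An $N$-cluster of $\Omega$ is an $N$-tuple $\mathcal E=(\mathcal E_1,\dots,\mathcal E_N)$ of Lebesgue measurable sets with $|\mathcal E_i\setminus\Omega|=0$, $|\mathcal E_i|>0$,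 $P(\mathcal E_i)<\infty$ for all $i$, and $|\mathcal E_i\cap\mathcal E_j|=0$ for $i\ne j$. The $(\Phi,N)$-Cheeger constant of $\Omega$ is $$H^{\Phi,N}(\Omega)=\inf\Big\{\Phi\Big(\tfrac{P(\mathcal E_1)}{|\mathcal E_1|},\dots,\tfrac{P(\mathcal E_N)}{|\mathcal E_N|}\Big):\ \mathcal E\text{ is an }N\text{-cluster of }\Omega\Big\}.$$ A $(1,N)$-function of $\Omega$ is an $N$-tuple $u=(u_1,\dots,u_N)$ of functions $u_i\in L^1(\mathbb{R}^d)$ with $|Du_i|(\mathbb{R}^d)<\infty$, $u_i=0$ a.e. in $\mathbb{R}^d\setminus\Omega$, $u_i\ge 0$ a.e., $\|u_i\|_{L^1}=1$, and $u_iu_j=0$ a.e. in $\Omega$ for $i\neq j$. A $(1,\Phi)$-eigen-$N$-function of $\Omega$ is a $(1,N)$-function of $\Omega$ which minimizes $\Phi\big(|Du_1|(\mathbb{R}^d),\dots,|Du_N|(\mathbb{R}^d)\big)$ among all $(1,N)$-functions of $\Omega$. Then every $(1,\Phi)$-eigen-$N$-function $u$ of $\Omega$ belongs to $L^\infty(\Omega;\mathbb{R}^N)$,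 and $$\|u_i\|_{L^\infty}\le\frac{1}{|B_1|}\left(\frac{H^{\Phi,N}(\Omega)}{\delta d}\right)^d\qquad\text{for } i=1,\dots,N,$$ where $\delta$ is any constant as in the coercivity condition. -/

import Mathlib

open MeasureTheory Set
open scoped ENNReal NNReal

namespace CheegerCluster

noncomputable section

/-- The Euclidean space `ℝ^d` (with the Euclidean norm and Lebesgue measure). -/
abbrev Space (d : ℕ) : Type := EuclideanSpace ℝ (Fin d)

/-- The divergence of a (differentiable) vector field on `ℝ^d`. -/
def divergence {d : ℕ} (φ : Space d → Space d) (x : Space d) : ℝ :=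
  ∑ i : Fin d, (fderiv ℝ φ x (EuclideanSpace.single i (1 : ℝ))) i

/-- Admissible test fields: `φ ∈ C¹_c(ℝ^d; ℝ^d)` with `|φ| ≤ 1` everywhere. -/
structure IsTestField {d : ℕ} (φ : Space d → Space d) : Prop where
  contDiff : ContDiff ℝ 1 φ
  hasCompactSupport : HasCompactSupport φ
  norm_le_one : ∀ x, ‖φ x‖ ≤ 1

/-- The total variation `|Du|(ℝ^d) ∈ [0,∞]` of a locally integrable function
`u : ℝ^d → ℝ`, as the supremum of `∫ u div φ` over admissible test fields. -/
def totalVariation {d : ℕ} (u : Space d → ℝ) : ℝ≥0∞ :=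
  ⨆ (φ : Space d → Space d) (_ : IsTestField φ),
    ENNReal.ofReal (∫ x, u x * divergence φ x)

/-- The (distributional) perimeter `P(E) ∈ [0,∞]` of a Lebesgue measurable set. -/
def perimeter {d : ℕ} (E : Set (Space d)) : ℝ≥0∞ :=
  totalVariation (E.indicator fun _ => (1 : ℝ))

/-- `N`-sets of `F`: `N`-tuples of Lebesgue measurable sets of positive measure, contained in `F`
up to null sets and with pairwise negligible intersections. -/
structure IsNSet {d N : ℕ} (F : Set (Space d)) (E : Fin N → Set (Space d)) : Prop where
  nullMeasurableSet : ∀ i, NullMeasurableSet (E i) volume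
  subset : ∀ i, volume (E i \ F) = 0
  volume_pos : ∀ i, 0 < volume (E i)
  disjoint : ∀ i j, i ≠ j → volume (E i ∩ E j) = 0

/-- `N`-clusters of `F`: `N`-sets all of whose chambers have finite perimeter. -/
structure IsNCluster {d N : ℕ} (F : Set (Space d)) (E : Fin N → Set (Space d)) : Prop
    extends IsNSet F E where
  perimeter_lt_top : ∀ i, perimeter (E i) < ∞

/-- The vector `(P(E_1)/|E_1|, …, P(E_N)/|E_N|) ∈ ℝ^N_+`; all entries are finite for clusters. -/
def ratio {d N : ℕ} (E : Fin N → Set (Space d)) : Fin N → ℝ≥0 :=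
  fun i => (perimeter (E i) / volume (E i)).toNNReal

/-- The `(Φ,N)`-Cheeger constant `H^{Φ,N}(F) ∈ [0,∞]`. -/
def cheegerConst {d N : ℕ} (Φ : (Fin N → ℝ≥0) → ℝ≥0) (F : Set (Space d)) : ℝ≥0∞ :=
  ⨅ (E : Fin N → Set (Space d)) (_ : IsNCluster F E), (Φ (ratio E) : ℝ≥0∞)

/-- `u ∈ BV_0(F)`: `u ∈ BV(ℝ^d)` and `u = 0` a.e. in `ℝ^d \ F`. -/
structure MemBVZero {d : ℕ} (F : Set (Space d)) (u : Space d → ℝ) : Prop where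
  integrable : Integrable u volume
  totalVariation_lt_top : totalVariation u < ∞
  eq_zero : ∀ᵐ x ∂(volume : Measure (Space d)), x ∉ F → u x = 0

/-- `(1,N)`-functions of `F`. -/
structure IsNFunction {d N : ℕ} (F : Set (Space d)) (u : Fin N → Space d → ℝ) : Prop where
  memBVZero : ∀ i, MemBVZero F (u i)
  nonneg : ∀ i, ∀ᵐ x ∂(volume : Measure (Space d)), x ∈ F → 0 ≤ u i x
  norm_eq_one : ∀ i, eLpNorm (u i) 1 (volume : Measure (Space d)) = 1
  mul_eq_zero : ∀ i j, i ≠ j →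
    ∀ᵐ x ∂(volume : Measure (Space d)), x ∈ F → u i x * u j x = 0

/-- The vector `[u]_1 = (|Du_1|(ℝ^d), …, |Du_N|(ℝ^d)) ∈ ℝ^N_+`, for `BV` components. -/
def variationVec {d N : ℕ} (u : Fin N → Space d → ℝ) : Fin N → ℝ≥0 :=
  fun i => (totalVariation (u i)).toNNReal

/-- The first `1`-functional `(Φ,N)`-eigenvalue `Λ^{Φ,N}_{1,1}(F) ∈ [0,∞]`. -/
def functionalEigenvalue {d N : ℕ} (Φ : (Fin N → ℝ≥0) → ℝ≥0) (F : Set (Space d)) : ℝ≥0∞ :=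
  ⨅ (u : Fin N → Space d → ℝ) (_ : IsNFunction F u), (Φ (variationVec u) : ℝ≥0∞)

/-- `(1,Φ)`-eigen-`N`-functions of `F`: the `(1,N)`-functions achieving the infimum. -/
def IsEigenNFunction {d N : ℕ} (Φ : (Fin N → ℝ≥0) → ℝ≥0) (F : Set (Space d))
    (u : Fin N → Space d → ℝ) : Prop :=
  IsNFunction F u ∧ (Φ (variationVec u) : ℝ≥0∞) = functionalEigenvalue Φ F

/-- `Φ` is coercive with constant `δ > 0`: `Φ(v) ≥ δ ‖v‖_1` for all `v ∈ ℝ^N_+`. -/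
def IsCoerciveWith {N : ℕ} (Φ : (Fin N → ℝ≥0) → ℝ≥0) (δ : ℝ) : Prop :=
  0 < δ ∧ ∀ v : Fin N → ℝ≥0, δ * ∑ i, (v i : ℝ) ≤ (Φ v : ℝ)

/-- `Φ` is strictly increasing: `Φ(v) < Φ(w)` whenever `v ≤ w` componentwise and
`v_i < w_i` for some `i`. -/
def IsStrictlyIncreasing {N : ℕ} (Φ : (Fin N → ℝ≥0) → ℝ≥0) : Prop :=
  ∀ v w : Fin N → ℝ≥0, (∀ i, v i ≤ w i) → (∃ i, v i < w i) → Φ v < Φ w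

end

end CheegerCluster

/-! Fix a component `u i` of an eigenfunction and put λ = |Du_i|. Because Φ is strictly increasing,
replacing `u i` by a normalised nonnegative competitor that vanishes wherever `u i` does cannot
lower the variation: λ ∫ v ≤ |Dv| for every such v (`IsEigenNFunction.mul_lintegral_le`).

Cut at height t, so that u_i = p + q with p = (u_i - t)⁺ and q = min(u_i, t). Both parts are
admissible, ∫ p + ∫ q = 1, and |Dp| + |Dq| ≤ λ (`totalVariation_posPart_add_min_le`); hence |Dp| ≤ λ
∫ p. By Chebyshev, p lives on a set of measure at most 1/t, the volume of a ball of some radius r,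
so the Cheeger–Faber–Krahn inequality `mul_lintegral_le_totalVariation` gives (d/r) ∫ p ≤ |Dp|.
Unless p = 0 a.e., d/r ≤ λ, that is t ≤ (λ/d)^d / |B_1|. This bounds u_i. Finally δλ ≤ Φ(|Du_1|, …,
|Du_N|) ≤ H, by coercivity and by testing minimality with normalised indicators of clusters.

The sharp constant d/r comes from Brunn–Minkowski, obtained from Prékopa–Leindler. For smooth f,
f(x) is at most f + ε|∇f| + o(ε) at any point within ε of x, so the ε-neighbourhood of a superlevel
set of f lies in a superlevel set of the latter function. Integrating the volume gain over all
levels bounds ∫ |∇f| from below. Mollification carries this, and the splitting under truncation,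
over to BV. -/

namespace CheegerCluster

open scoped Pointwise Topology Convolution

open ContinuousLinearMap (lsmul)

/-! ### The Prékopa–Leindler inequality. -/

section PrekopaLeindler

/-- The one-dimensional Brunn–Minkowski inequality for compact sets. -/
lemma volume_add_volume_le_of_isCompact {K L : Set ℝ} (hK : IsCompact K) (hL : IsCompact L)
    (hKn : K.Nonempty) (hLn : L.Nonempty) : volume K + volume L ≤ volume (K + L) := by
  obtain ⟨a, haK, ha⟩ := hK.exists_isGreatest hKn
  obtain ⟨b, hbL, hb⟩ := hL.exists_isLeast hLn
  -- With a the maximum of K and b the minimum of L, the translate b + K lies to the left of a + b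
  -- and a + L to its right.
  have hinter : ((b +ᵥ K) ∩ (a +ᵥ L)) ⊆ {a + b} := by
    rintro x ⟨⟨k, hk, rfl⟩, ⟨l, hl, hkl⟩⟩
    have h1 := ha hk
    have h2 := hb hl
    simp only [vadd_eq_add, mem_singleton_iff] at hkl ⊢
    linarith
  have hnull : volume ((b +ᵥ K) ∩ (a +ᵥ L)) = 0 := measure_mono_null hinter (by simp)
  have hunion : (b +ᵥ K) ∪ (a +ᵥ L) ⊆ K + L := by
    rintro x (⟨k, hk, rfl⟩ | ⟨l, hl, rfl⟩)
    · exact ⟨k, hk, b, hbL, add_comm _ _⟩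
    · exact ⟨a, haK, l, hl, rfl⟩
  calc volume K + volume L = volume (b +ᵥ K) + volume (a +ᵥ L) := by
        rw [measure_vadd, measure_vadd]
    _ = volume ((b +ᵥ K) ∪ (a +ᵥ L)) + volume ((b +ᵥ K) ∩ (a +ᵥ L)) :=
        (measure_union_add_inter _ (hL.vadd a).measurableSet).symm
    _ ≤ volume (K + L) := by rw [hnull, add_zero]; exact measure_mono hunion

/-- The one-dimensional Brunn–Minkowski inequality. -/
lemma volume_add_volume_le {A B C : Set ℝ} (hA : MeasurableSet A) (hB : MeasurableSet B)
    (hAn : A.Nonempty) (hBn : B.Nonempty) (hC : ∀ x ∈ A, ∀ y ∈ B, x + y ∈ C) :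
    volume A + volume B ≤ volume C := by
  have key : ∀ K ⊆ A, IsCompact K → ∀ L ⊆ B, IsCompact L → volume K + volume L ≤ volume C := by
    intro K hKA hK L hLB hL
    obtain ⟨a, ha⟩ := hAn
    obtain ⟨b, hb⟩ := hBn
    -- A compact subset may be empty, which would make the sumset empty; adjoining a point of A and
    -- one of B avoids this.
    calc volume K + volume L ≤ volume (insert a K) + volume (insert b L) := by
          gcongr <;> exact subset_insert _ _
      _ ≤ volume (insert a K + insert b L) :=
          volume_add_volume_le_of_isCompact (hK.insert a) (hL.insert b) (insert_nonempty _ _)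
            (insert_nonempty _ _)
      _ ≤ volume C := by
          apply measure_mono
          rintro _ ⟨x, hx, y, hy, rfl⟩
          exact hC x (insert_subset ha hKA hx) y (insert_subset hb hLB hy)
  rw [hA.measure_eq_iSup_isCompact, hB.measure_eq_iSup_isCompact]
  simp only [iSup_and']
  refine ENNReal.biSup_add_biSup_le' ⟨∅, empty_subset _, isCompact_empty⟩
    ⟨∅, empty_subset _, isCompact_empty⟩ ?_
  intro K hK L hL
  exact key K hK.1 hK.2 L hL.1 hL.2

lemma volume_smul_real {c : ℝ} (hc : 0 < c) (A : Set ℝ) :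
    volume (c • A) = ENNReal.ofReal c * volume A := by
  rw [Measure.addHaar_smul]; simp [abs_of_pos hc]

lemma lintegral_eq_lintegral_meas_lt_ennreal {α : Type*} [MeasurableSpace α] (μ : Measure α)
    {f : α → ℝ≥0∞} (hf : Measurable f) (hfin : ∀ x, f x ≠ ∞) :
    ∫⁻ x, f x ∂μ = ∫⁻ t in Ioi (0 : ℝ), μ {x | ENNReal.ofReal t < f x} := by
  have h1 := lintegral_eq_lintegral_meas_lt μ (f := fun x => (f x).toReal)
    (Filter.Eventually.of_forall fun x => ENNReal.toReal_nonneg) hf.ennreal_toReal.aemeasurable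
  simp only [ENNReal.ofReal_toReal (hfin _)] at h1
  rw [h1]
  refine setLIntegral_congr_fun measurableSet_Ioi fun t ht => ?_
  congr 1
  ext x
  exact (ENNReal.ofReal_lt_iff_lt_toReal (le_of_lt ht) (hfin x)).symm

lemma geom_mean_le_arith_mean {p q : ℝ} (hp : 0 < p) (hq : 0 < q) (hpq : p + q = 1)
    (a b : ℝ≥0∞) : a ^ p * b ^ q ≤ ENNReal.ofReal p * a + ENNReal.ofReal q * b := by
  rcases eq_or_ne a ∞ with rfl | ha
  · simp [ENNReal.mul_top, hp]
  rcases eq_or_ne b ∞ with rfl | hb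
  · simp [ENNReal.mul_top, hq]
  lift a to ℝ≥0 using ha
  lift b to ℝ≥0 using hb
  have := NNReal.geom_mean_le_arith_mean2_weighted ⟨p, hp.le⟩ ⟨q, hq.le⟩ a b
    (NNReal.eq hpq)
  rw [← ENNReal.coe_rpow_of_nonneg _ hp.le, ← ENNReal.coe_rpow_of_nonneg _ hq.le]
  rw [ENNReal.ofReal_eq_coe_nnreal hp.le, ENNReal.ofReal_eq_coe_nnreal hq.le]
  exact_mod_cast this

/-- The Prékopa–Leindler inequality on the line for functions normalised to have supremum `1`. -/
lemma prekopa_leindler_real_of_iSup_eq_one {p q : ℝ} (hp : 0 < p) (hq : 0 < q) (hpq : p + q = 1)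
    {f g h : ℝ → ℝ≥0∞} (hf : Measurable f) (hg : Measurable g) (hh : Measurable h)
    (hf1 : ⨆ x, f x = 1) (hg1 : ⨆ x, g x = 1)
    (H : ∀ x y, f x ^ p * g y ^ q ≤ h (p * x + q * y)) :
    (∫⁻ x, f x) ^ p * (∫⁻ x, g x) ^ q ≤ ∫⁻ x, h x := by
  have hfle : ∀ x, f x ≤ 1 := fun x => hf1 ▸ le_iSup f x
  have hgle : ∀ x, g x ≤ 1 := fun x => hg1 ▸ le_iSup g x
  -- Only levels below 1 matter, so capping h at 1 loses nothing and gives the finite values that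
  -- the layer-cake formula asks for.
  let k : ℝ → ℝ≥0∞ := fun x => min (h x) 1
  have hk : Measurable k := hh.min measurable_const
  -- Here the normalisation enters: for t < 1 both superlevel sets are nonempty, as Brunn–Minkowski
  -- requires, and for t ≥ 1 both are empty.
  have level : ∀ t ∈ Ioi (0 : ℝ),
      ENNReal.ofReal p * volume {x | ENNReal.ofReal t < f x} +
        ENNReal.ofReal q * volume {x | ENNReal.ofReal t < g x} ≤
      volume {x | ENNReal.ofReal t < k x} := by
    intro t ht
    rcases lt_or_ge t 1 with ht1 | ht1
    · have ht1' : ENNReal.ofReal t < 1 := by simpa using ht1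
      obtain ⟨a, ha⟩ := lt_iSup_iff.1 (hf1 ▸ ht1')
      obtain ⟨b, hb⟩ := lt_iSup_iff.1 (hg1 ▸ ht1')
      rw [← volume_smul_real hp, ← volume_smul_real hq]
      refine volume_add_volume_le ((measurableSet_lt measurable_const hf).const_smul₀ p)
        ((measurableSet_lt measurable_const hg).const_smul₀ q) ⟨p • a, a, ha, rfl⟩
        ⟨q • b, b, hb, rfl⟩ ?_
      rintro _ ⟨x, hx, rfl⟩ _ ⟨y, hy, rfl⟩
      simp only [mem_ofPred_eq] at hx hy
      simp only [smul_eq_mul, mem_ofPred_eq, k, lt_min_iff, ht1', and_true]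
      refine lt_of_lt_of_le ?_ (H x y)
      calc ENNReal.ofReal t = ENNReal.ofReal t ^ p * ENNReal.ofReal t ^ q := by
            rw [← ENNReal.rpow_add_of_nonneg _ _ hp.le hq.le, hpq, ENNReal.rpow_one]
        _ < f x ^ p * g y ^ q :=
            ENNReal.mul_lt_mul (ENNReal.rpow_lt_rpow hx hp) (ENNReal.rpow_lt_rpow hy hq)
    · have h1 : ∀ f : ℝ → ℝ≥0∞, (∀ x, f x ≤ 1) → {x | ENNReal.ofReal t < f x} = ∅ := by
        intro f hf
        ext x
        simp only [mem_ofPred_eq, mem_empty_iff_false, iff_false, not_lt]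
        exact (hf x).trans (by simpa using ht1)
      simp [h1 f hfle, h1 g hgle]
  have hne : ∀ {f : ℝ → ℝ≥0∞}, (∀ x, f x ≤ 1) → ∀ x, f x ≠ ∞ :=
    fun h x => ne_top_of_le_ne_top ENNReal.one_ne_top (h x)
  have hm : ∀ f : ℝ → ℝ≥0∞, Measurable fun t : ℝ => volume {x | ENNReal.ofReal t < f x} := by
    intro f
    refine Antitone.measurable fun s t hst => measure_mono fun x hx => ?_
    exact lt_of_le_of_lt (ENNReal.ofReal_le_ofReal hst) hx
  calc (∫⁻ x, f x) ^ p * (∫⁻ x, g x) ^ q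
      ≤ ENNReal.ofReal p * (∫⁻ x, f x) + ENNReal.ofReal q * ∫⁻ x, g x :=
        geom_mean_le_arith_mean hp hq hpq _ _
    _ = ∫⁻ t in Ioi (0 : ℝ), (ENNReal.ofReal p * volume {x | ENNReal.ofReal t < f x} +
        ENNReal.ofReal q * volume {x | ENNReal.ofReal t < g x}) := by
        rw [lintegral_eq_lintegral_meas_lt_ennreal _ hf (hne hfle),
          lintegral_eq_lintegral_meas_lt_ennreal _ hg (hne hgle),
          lintegral_add_left ((hm f).const_mul _), lintegral_const_mul _ (hm f),
          lintegral_const_mul _ (hm g)]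
    _ ≤ ∫⁻ t in Ioi (0 : ℝ), volume {x | ENNReal.ofReal t < k x} :=
        setLIntegral_mono' measurableSet_Ioi level
    _ = ∫⁻ x, k x :=
        (lintegral_eq_lintegral_meas_lt_ennreal _ hk (hne fun x => min_le_right _ _)).symm
    _ ≤ ∫⁻ x, h x := lintegral_mono fun x => min_le_left _ _

/-- The Prékopa–Leindler inequality on the line for bounded functions. -/
lemma prekopa_leindler_real_of_iSup_ne_top {p q : ℝ} (hp : 0 < p) (hq : 0 < q) (hpq : p + q = 1)
    {f g h : ℝ → ℝ≥0∞} (hf : Measurable f) (hg : Measurable g) (hh : Measurable h)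
    (hf1 : ⨆ x, f x ≠ ∞) (hg1 : ⨆ x, g x ≠ ∞)
    (H : ∀ x y, f x ^ p * g y ^ q ≤ h (p * x + q * y)) :
    (∫⁻ x, f x) ^ p * (∫⁻ x, g x) ^ q ≤ ∫⁻ x, h x := by
  set F := ⨆ x, f x with hF
  set G := ⨆ x, g x with hG
  rcases eq_or_ne F 0 with hF0 | hF0
  · have : f = 0 := funext fun x => le_zero_iff.1 ((le_iSup f x).trans_eq hF0)
    simp [this, hp]
  rcases eq_or_ne G 0 with hG0 | hG0
  · have : g = 0 := funext fun x => le_zero_iff.1 ((le_iSup g x).trans_eq hG0)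
    simp [this, hq]
  -- The hypothesis is homogeneous: dividing f by F and g by G divides h by F^p G^q.
  have key := prekopa_leindler_real_of_iSup_eq_one hp hq hpq (hf.const_mul F⁻¹)
    (hg.const_mul G⁻¹) (hh.const_mul ((F⁻¹) ^ p * (G⁻¹) ^ q))
    (by rw [← ENNReal.mul_iSup, ← hF, ENNReal.inv_mul_cancel hF0 hf1])
    (by rw [← ENNReal.mul_iSup, ← hG, ENNReal.inv_mul_cancel hG0 hg1])
    (fun x y => by
      rw [ENNReal.mul_rpow_of_nonneg _ _ hp.le, ENNReal.mul_rpow_of_nonneg _ _ hq.le,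
        mul_mul_mul_comm]
      gcongr
      exact H x y)
  rw [lintegral_const_mul _ hf, lintegral_const_mul _ hg, lintegral_const_mul _ hh,
    ENNReal.mul_rpow_of_nonneg _ _ hp.le, ENNReal.mul_rpow_of_nonneg _ _ hq.le,
    mul_mul_mul_comm] at key
  refine (ENNReal.mul_le_mul_iff_right ?_ ?_).1 key
  · simp [hf1, hg1, hp.le, hq.le, ENNReal.rpow_eq_zero_iff]
  · simp [ENNReal.mul_eq_top, ENNReal.rpow_eq_top_iff, ENNReal.rpow_eq_zero_iff, hF0, hG0, hf1,
      hg1, hp.not_gt, hq.not_gt]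

lemma tendsto_lintegral_min_natCast {α : Type*} [MeasurableSpace α] {μ : Measure α}
    {f : α → ℝ≥0∞} (hf : Measurable f) :
    Filter.Tendsto (fun n : ℕ => ∫⁻ x, min (f x) n ∂μ) Filter.atTop (nhds (∫⁻ x, f x ∂μ)) := by
  refine lintegral_tendsto_of_tendsto_of_monotone
    (fun n => (hf.min measurable_const).aemeasurable)
    (Filter.Eventually.of_forall fun x m n hmn => min_le_min_left _ (by exact_mod_cast hmn))
    (Filter.Eventually.of_forall fun x => ?_)
  have := (tendsto_const_nhds (x := f x) (f := Filter.atTop)).min ENNReal.tendsto_nat_nhds_top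
  simpa using this

/-- The Prékopa–Leindler inequality on the line. -/
lemma prekopa_leindler_real {p q : ℝ} (hp : 0 < p) (hq : 0 < q) (hpq : p + q = 1)
    {f g h : ℝ → ℝ≥0∞} (hf : Measurable f) (hg : Measurable g) (hh : Measurable h)
    (H : ∀ x y, f x ^ p * g y ^ q ≤ h (p * x + q * y)) :
    (∫⁻ x, f x) ^ p * (∫⁻ x, g x) ^ q ≤ ∫⁻ x, h x := by
  have hb : ∀ (f : ℝ → ℝ≥0∞) (n : ℕ), ⨆ x, min (f x) n ≠ ∞ := fun f n =>
    ne_top_of_le_ne_top (ENNReal.natCast_ne_top n) (iSup_le fun x => min_le_right _ _)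
  -- The two truncation heights are independent so that the supremum of the product factors after
  -- monotone convergence.
  have key : ∀ m n : ℕ,
      (∫⁻ x, min (f x) m) ^ p * (∫⁻ x, min (g x) n) ^ q ≤ ∫⁻ x, h x := fun m n =>
    prekopa_leindler_real_of_iSup_ne_top hp hq hpq (hf.min measurable_const)
      (hg.min measurable_const) hh (hb f m) (hb g n) fun x y => by
        refine le_trans ?_ (H x y)
        gcongr <;> exact min_le_left _ _
  have mono : ∀ {f : ℝ → ℝ≥0∞}, Measurable f → ∫⁻ x, f x = ⨆ n : ℕ, ∫⁻ x, min (f x) n := by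
    intro f hf
    refine tendsto_nhds_unique (tendsto_lintegral_min_natCast hf) (tendsto_atTop_iSup ?_)
    intro m n hmn
    exact lintegral_mono fun x => min_le_min_left _ (by exact_mod_cast hmn)
  have hsup : ∀ (a : ℕ → ℝ≥0∞) {p : ℝ}, 0 < p → (⨆ n, a n) ^ p = ⨆ n, a n ^ p := by
    intro a p hp
    exact (ENNReal.orderIsoRpow p hp).map_iSup a
  rw [mono hf, mono hg, hsup _ hp, hsup _ hq, ENNReal.iSup_mul]
  refine iSup_le fun m => ?_
  rw [ENNReal.mul_iSup]
  exact iSup_le fun n => key m n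

/-- The **Prékopa–Leindler inequality** on `ℝⁿ`. -/
theorem prekopa_leindler {p q : ℝ} (hp : 0 < p) (hq : 0 < q) (hpq : p + q = 1) (n : ℕ) :
    ∀ {f g h : (Fin n → ℝ) → ℝ≥0∞}, Measurable f → Measurable g → Measurable h →
    (∀ x y, f x ^ p * g y ^ q ≤ h (p • x + q • y)) →
    (∫⁻ x, f x) ^ p * (∫⁻ x, g x) ^ q ≤ ∫⁻ x, h x := by
  induction n with
  | zero =>
    intro f g h _ _ _ H
    have e : ∀ f : (Fin 0 → ℝ) → ℝ≥0∞, ∫⁻ x, f x = f 0 := by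
      intro f
      rw [volume_pi, Measure.pi_of_empty _ 0, lintegral_dirac]
    simpa [e] using H 0 0
  | succ n ih =>
    intro f g h hf hg hh H
    let e := (MeasurableEquiv.piFinSuccAbove (fun _ : Fin (n + 1) => ℝ) 0).symm
    have he : MeasurePreserving e :=
      (volume_preserving_piFinSuccAbove (fun _ : Fin (n + 1) => ℝ) 0).symm
    have fub : ∀ {f : (Fin (n + 1) → ℝ) → ℝ≥0∞}, Measurable f →
        ∫⁻ x, f x = ∫⁻ s : ℝ, ∫⁻ y : Fin n → ℝ, f (e (s, y)) := by
      intro f hf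
      rw [← he.lintegral_comp hf, Measure.volume_eq_prod]
      exact lintegral_prod (fun a => f (e a)) (hf.comp e.measurable).aemeasurable
    have hm : ∀ {f : (Fin (n + 1) → ℝ) → ℝ≥0∞}, Measurable f →
        Measurable fun s : ℝ => ∫⁻ y : Fin n → ℝ, f (e (s, y)) := fun hf =>
      (hf.comp e.measurable).lintegral_prod_right'
    have hlin : ∀ s t y z, e (p * s + q * t, p • y + q • z) = p • e (s, y) + q • e (t, z) := by
      intro s t y z
      ext i
      refine Fin.cases ?_ (fun j => ?_) i <;>
        simp [e, MeasurableEquiv.piFinSuccAbove, Fin.insertNthEquiv]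
    rw [fub hf, fub hg, fub hh]
    -- For fixed s and t the slices satisfy the hypothesis in dimension n, so by induction their
    -- integrals, as functions of the first coordinate, satisfy it on the line.
    refine prekopa_leindler_real hp hq hpq (hm hf) (hm hg) (hm hh) fun s t => ?_
    refine ih (hf.comp (e.measurable.comp measurable_prodMk_left))
      (hg.comp (e.measurable.comp measurable_prodMk_left))
      (hh.comp (e.measurable.comp measurable_prodMk_left)) fun y z => ?_
    exact (H _ _).trans_eq (congrArg h (hlin s t y z).symm)

end PrekopaLeindler

/-! ### Brunn–Minkowski for neighbourhoods of sets. -/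

section BrunnMinkowski

variable {d : ℕ}

lemma volume_ball_eq (hd : 1 ≤ d) {r : ℝ} (hr : 0 ≤ r) :
    volume (Metric.ball (0 : Space d) r) =
      ENNReal.ofReal (r ^ d) * volume (Metric.ball (0 : Space d) 1) := by
  have : Nonempty (Fin d) := ⟨⟨0, hd⟩⟩
  rw [Measure.addHaar_ball _ _ hr]
  simp

lemma volume_ball_one_pos : 0 < volume (Metric.ball (0 : Space d) 1) :=
  Metric.measure_ball_pos _ _ one_pos

lemma volume_ball_one_ne_top : volume (Metric.ball (0 : Space d) 1) ≠ ∞ :=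
  measure_ball_lt_top.ne

/-- Prékopa–Leindler on Euclidean space, for indicator functions. -/
lemma volume_rpow_mul_volume_rpow_le {p q : ℝ} (hp : 0 < p) (hq : 0 < q) (hpq : p + q = 1)
    {A B C : Set (Space d)} (hA : MeasurableSet A) (hB : MeasurableSet B) (hC : MeasurableSet C)
    (H : ∀ x ∈ A, ∀ y ∈ B, p • x + q • y ∈ C) :
    volume A ^ p * volume B ^ q ≤ volume C := by
  have hT := PiLp.volume_preserving_toLp (Fin d)
  have meas : ∀ {A : Set (Space d)}, MeasurableSet A →
      ∫⁻ x : Fin d → ℝ, A.indicator 1 (WithLp.toLp 2 x) = volume A := by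
    intro A hA
    have hA1 : Measurable (A.indicator (1 : Space d → ℝ≥0∞)) := measurable_one.indicator hA
    rw [hT.lintegral_comp hA1, lintegral_indicator_one hA]
  have hm : ∀ {A : Set (Space d)}, MeasurableSet A →
      Measurable fun x : Fin d → ℝ => A.indicator (1 : Space d → ℝ≥0∞) (WithLp.toLp 2 x) :=
    fun hA => (measurable_one.indicator hA).comp hT.measurable
  rw [← meas hA, ← meas hB, ← meas hC]
  refine prekopa_leindler hp hq hpq d (hm hA) (hm hB) (hm hC) fun x y => ?_
  by_cases hx : WithLp.toLp 2 x ∈ A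
  · by_cases hy : WithLp.toLp 2 y ∈ B
    · have := H _ hx _ hy
      simp only [WithLp.toLp_add, WithLp.toLp_smul]
      simp [hx, hy, this]
    · simp [hy, hq]
  · simp [hx, hp]

/-- The Brunn–Minkowski inequality when one of the sets is a ball. -/
lemma volume_ball_add_le (hd : 1 ≤ d) {A C : Set (Space d)} (hA : MeasurableSet A)
    (hC : MeasurableSet C) {a ε : ℝ} (ha : 0 < a) (hε : 0 < ε)
    (hvol : volume A = volume (Metric.ball (0 : Space d) a))
    (H : ∀ x ∈ A, ∀ y ∈ Metric.ball (0 : Space d) ε, x + y ∈ C) :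
    volume (Metric.ball (0 : Space d) (a + ε)) ≤ volume C := by
  have hs : 0 < a + ε := by positivity
  set s := a + ε with hsdef
  have hp : 0 < a / s := by positivity
  have hq : 0 < ε / s := by positivity
  have hpq : a / s + ε / s = 1 := by rw [← add_div, div_self hs.ne']
  -- The weights a/s and ε/s write A + B_ε as a convex combination of (s/a)A and B_s. These have
  -- equal volume, so their geometric mean is |B_s| without loss.
  have hvA : volume ((s / a) • A) = volume (Metric.ball (0 : Space d) s) := by
    rw [Measure.addHaar_smul, hvol, volume_ball_eq hd ha.le, volume_ball_eq hd hs.le, ← mul_assoc,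
      ← ENNReal.ofReal_mul (abs_nonneg _)]
    congr 2
    rw [finrank_euclideanSpace_fin, abs_of_pos (by positivity), div_pow]
    field_simp
  have key := volume_rpow_mul_volume_rpow_le hp hq hpq (hA.const_smul₀ (s / a))
    (Metric.isOpen_ball (x := (0 : Space d)) (ε := s)).measurableSet hC (by
      rintro _ ⟨x, hx, rfl⟩ y hy
      have e : (a / s) • (s / a) • x = x := by
        rw [smul_smul, div_mul_div_cancel₀ hs.ne', div_self ha.ne', one_smul]
      simp only [e]
      refine H x hx _ ?_
      rw [mem_ball_zero_iff] at hy ⊢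
      rw [norm_smul, Real.norm_of_nonneg hq.le]
      calc ε / s * ‖y‖ < ε / s * s := by gcongr
        _ = ε := div_mul_cancel₀ _ hs.ne')
  rwa [hvA, ← ENNReal.rpow_add_of_nonneg _ _ hp.le hq.le, hpq, ENNReal.rpow_one] at key

/-- Bernoulli gives (a + ε)^d ≥ a^d + d a^(d-1) ε, and r a^(d-1) dominates the smaller of a^d and
r^d. The minimum keeps the bound valid for sets larger than the comparison ball, which mollified
functions may produce. -/
lemma min_pow_div_le (hd : 1 ≤ d) {a r ε : ℝ} (ha : 0 ≤ a) (hr : 0 < r) (hε : 0 ≤ ε) :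
    a ^ d + ε * (d / r) * min (a ^ d) (r ^ d) ≤ (a + ε) ^ d := by
  obtain ⟨k, rfl⟩ : ∃ k, d = k + 1 := ⟨d - 1, by omega⟩
  have h1 : min (a ^ (k + 1)) (r ^ (k + 1)) ≤ r * a ^ k := by
    rcases le_total a r with h | h
    · refine (min_le_left _ _).trans ?_
      rw [pow_succ']
      gcongr
    · refine (min_le_right _ _).trans ?_
      rw [pow_succ']
      gcongr
  have h2 : a ^ (k + 1) + (k + 1 : ℕ) * a ^ k * ε ≤ (a + ε) ^ (k + 1) := by
    rcases ha.eq_or_lt with rfl | ha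
    · rcases k.eq_zero_or_pos with rfl | hk
      · simp
      · simp [hk.ne']; positivity
    · have := one_add_mul_le_pow (a := ε / a) (by linarith [show 0 ≤ ε / a by positivity]) (k + 1)
      calc a ^ (k + 1) + (k + 1 : ℕ) * a ^ k * ε
          = a ^ (k + 1) * (1 + (k + 1 : ℕ) * (ε / a)) := by field_simp; ring
        _ ≤ a ^ (k + 1) * (1 + ε / a) ^ (k + 1) := by gcongr
        _ = (a + ε) ^ (k + 1) := by rw [← mul_pow]; congr 1; field_simp
  refine le_trans ?_ h2
  have : ε * ((k + 1 : ℕ) / r) * min (a ^ (k + 1)) (r ^ (k + 1)) ≤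
      ε * ((k + 1 : ℕ) / r) * (r * a ^ k) := by gcongr
  calc _ ≤ a ^ (k + 1) + ε * ((k + 1 : ℕ) / r) * (r * a ^ k) := by gcongr
    _ = _ := by field_simp

/-- A linearised Brunn–Minkowski inequality for the `ε`-neighbourhood of a set. -/
lemma volume_add_mul_min_le (hd : 1 ≤ d) {A C : Set (Space d)} (hA : MeasurableSet A)
    (hC : MeasurableSet C) (hAfin : volume A ≠ ∞) {r ε : ℝ} (hr : 0 < r) (hε : 0 < ε)
    (H : ∀ x ∈ A, ∀ y ∈ Metric.ball (0 : Space d) ε, x + y ∈ C) :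
    volume A + ENNReal.ofReal (ε * (d / r)) *
      min (volume A) (volume (Metric.ball (0 : Space d) r)) ≤ volume C := by
  rcases eq_or_ne (volume A) 0 with h0 | h0
  · simp [h0]
  set b := volume (Metric.ball (0 : Space d) 1) with hb
  have hb0 : b ≠ 0 := volume_ball_one_pos.ne'
  have hbt : b ≠ ∞ := volume_ball_one_ne_top
  obtain ⟨a, ha, hA'⟩ : ∃ a : ℝ, 0 < a ∧ volume A = volume (Metric.ball (0 : Space d) a) := by
    have hpos : 0 < (volume A / b).toReal :=
      ENNReal.toReal_pos (ENNReal.div_pos h0 hbt).ne' (ENNReal.div_ne_top hAfin hb0)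
    refine ⟨(volume A / b).toReal ^ (1 / d : ℝ), by positivity, ?_⟩
    rw [volume_ball_eq hd (by positivity), ← Real.rpow_natCast, ← Real.rpow_mul hpos.le,
      one_div_mul_cancel (by positivity), Real.rpow_one,
      ENNReal.ofReal_toReal (ENNReal.div_ne_top hAfin hb0), ← hb, ENNReal.div_mul_cancel hb0 hbt]
  refine le_trans ?_ (volume_ball_add_le hd hA hC ha hε hA' H)
  rw [hA', volume_ball_eq hd ha.le, volume_ball_eq hd hr.le,
    volume_ball_eq (r := a + ε) hd (by positivity), ← min_mul_of_nonneg _ _ (by positivity), ← ENNReal.ofReal_min, ← mul_assoc,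
    ← ENNReal.ofReal_mul (by positivity), ← add_mul,
    ← ENNReal.ofReal_add (by positivity) (by positivity)]
  gcongr
  exact min_pow_div_le hd ha.le hr hε.le

end BrunnMinkowski

/-! ### Gradients, and the isoperimetric inequality for smooth functions. -/

section Gradient

variable {d : ℕ}

/-- The gradient of a function on `ℝ^d`, as the vector of its partial derivatives. -/
noncomputable def grad {d : ℕ} (f : Space d → ℝ) (x : Space d) : Space d :=
  WithLp.toLp 2 fun i => fderiv ℝ f x (EuclideanSpace.single i (1 : ℝ))

lemma sum_smul_single (v : Space d) : ∑ i, v i • EuclideanSpace.single i (1 : ℝ) = v := by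
  ext j
  simp [Finset.sum_apply, Pi.single_apply]

lemma fderiv_apply_eq_sum (f : Space d → ℝ) (x v : Space d) :
    fderiv ℝ f x v = ∑ i, fderiv ℝ f x (EuclideanSpace.single i (1 : ℝ)) * v i := by
  conv_lhs => rw [← sum_smul_single v]
  simp [map_sum, mul_comm]

lemma inner_grad (f : Space d → ℝ) (x v : Space d) : inner ℝ (grad f x) v = fderiv ℝ f x v := by
  rw [fderiv_apply_eq_sum, PiLp.inner_apply]
  simp [grad, mul_comm]

lemma norm_fderiv_le_norm_grad (f : Space d → ℝ) (x : Space d) :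
    ‖fderiv ℝ f x‖ ≤ ‖grad f x‖ :=
  ContinuousLinearMap.opNorm_le_bound _ (norm_nonneg _) fun v => by
    rw [← inner_grad]
    exact norm_inner_le_norm _ _

lemma contDiff_grad {f : Space d → ℝ} {n : ℕ} (hf : ContDiff ℝ (n + 1) f) :
    ContDiff ℝ n (grad f) := by
  rw [contDiff_euclidean]
  intro i
  exact (hf.fderiv_right le_rfl).clm_apply contDiff_const

lemma continuous_grad {f : Space d → ℝ} (hf : ContDiff ℝ 1 f) : Continuous (grad f) :=
  (contDiff_grad (n := 0) (by simpa using hf)).continuous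

lemma hasCompactSupport_grad {f : Space d → ℝ} (hf : HasCompactSupport f) :
    HasCompactSupport (grad f) := by
  refine hf.mono' fun x hx => ?_
  by_contra h
  refine hx ?_
  have : fderiv ℝ f x = 0 := by
    by_contra h0
    exact h (support_fderiv_subset ℝ h0)
  ext i
  simp [grad, this]

lemma grad_eq_zero_of_notMem_tsupport {f : Space d → ℝ} {x : Space d} (hx : x ∉ tsupport f) :
    grad f x = 0 := by
  have : fderiv ℝ f x = 0 := by
    by_contra h0
    exact hx (support_fderiv_subset ℝ h0)
  ext i
  simp [grad, this]

lemma continuous_divergence {φ : Space d → Space d} (hφ : ContDiff ℝ 1 φ) :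
    Continuous (divergence φ) := by
  refine continuous_finsetSum _ fun i _ => ?_
  have : Continuous fun x => fderiv ℝ φ x (EuclideanSpace.single i (1 : ℝ)) :=
    (hφ.continuous_fderiv one_ne_zero).clm_apply continuous_const
  exact (EuclideanSpace.proj (𝕜 := ℝ) i).continuous.comp this

lemma hasCompactSupport_divergence {φ : Space d → Space d} (hφ : HasCompactSupport φ) :
    HasCompactSupport (divergence φ) := by
  refine hφ.mono' fun x hx => ?_
  by_contra h
  refine hx ?_
  have : fderiv ℝ φ x = 0 := by
    by_contra h0
    exact h (support_fderiv_subset ℝ h0)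
  simp [divergence, this]

/-- Integration by parts against a compactly supported vector field. -/
lemma integral_mul_divergence {f : Space d → ℝ} {φ : Space d → Space d} (hf : ContDiff ℝ 1 f)
    (hφ : ContDiff ℝ 1 φ) (hφc : HasCompactSupport φ) :
    ∫ x, f x * divergence φ x = -∫ x, inner ℝ (grad f x) (φ x) := by
  have hfd : Continuous fun x => fderiv ℝ f x := hf.continuous_fderiv one_ne_zero
  have hφd : Continuous fun x => fderiv ℝ φ x := hφ.continuous_fderiv one_ne_zero
  have hcoord : ∀ i : Fin d, ContDiff ℝ 1 fun x => φ x i := fun i => (contDiff_euclidean.1 hφ) i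
  have hcoordc : ∀ i : Fin d, HasCompactSupport fun x => φ x i := fun i =>
    hφc.comp_left (g := fun v : Space d => v i) rfl
  have hfdc : ∀ (i : Fin d) (x : Space d), fderiv ℝ (fun y => φ y i) x
      (EuclideanSpace.single i (1 : ℝ)) = fderiv ℝ φ x (EuclideanSpace.single i (1 : ℝ)) i := by
    intro i x
    have h := ((EuclideanSpace.proj (𝕜 := ℝ) i).hasFDerivAt (x := φ x)).comp x
      (hφ.differentiable one_ne_zero x).hasFDerivAt
    have h' : HasFDerivAt (fun y => φ y i) _ x := h
    rw [h'.fderiv]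
    rfl
  have hcd : ∀ i : Fin d, Continuous fun x => fderiv ℝ (fun y => φ y i) x
      (EuclideanSpace.single i (1 : ℝ)) := fun i =>
    ((hcoord i).continuous_fderiv one_ne_zero).clm_apply continuous_const
  have hcdc : ∀ i : Fin d, HasCompactSupport fun x => fderiv ℝ (fun y => φ y i) x
      (EuclideanSpace.single i (1 : ℝ)) := fun i =>
    ((hcoordc i).fderiv ℝ).comp_left (g := fun T : Space d →L[ℝ] ℝ => T _) (by simp)
  have hint1 : ∀ i : Fin d, Integrable fun x => f x * fderiv ℝ (fun y => φ y i) x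
      (EuclideanSpace.single i (1 : ℝ)) := fun i =>
    (hf.continuous.mul (hcd i)).integrable_of_hasCompactSupport (hcdc i).mul_left
  have hint2 : ∀ i : Fin d, Integrable fun x =>
      fderiv ℝ f x (EuclideanSpace.single i (1 : ℝ)) * φ x i := fun i =>
    ((hfd.clm_apply continuous_const).mul (hcoord i).continuous).integrable_of_hasCompactSupport
      (hcoordc i).mul_left
  have hint3 : ∀ i : Fin d, Integrable fun x => f x * φ x i := fun i =>
    (hf.continuous.mul (hcoord i).continuous).integrable_of_hasCompactSupport (hcoordc i).mul_left
  calc ∫ x, f x * divergence φ x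
      = ∫ x, ∑ i, f x * fderiv ℝ (fun y => φ y i) x (EuclideanSpace.single i (1 : ℝ)) := by
        simp only [divergence, Finset.mul_sum, hfdc]
    _ = ∑ i, -∫ x, fderiv ℝ f x (EuclideanSpace.single i (1 : ℝ)) * φ x i := by
        rw [integral_finsetSum _ fun i _ => hint1 i]
        refine Finset.sum_congr rfl fun i _ => ?_
        exact integral_mul_fderiv_eq_neg_fderiv_mul_of_integrable (hint2 i) (hint1 i) (hint3 i)
          (fun x _ => hf.differentiable one_ne_zero x)
          (fun x _ => (hcoord i).differentiable one_ne_zero x)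
    _ = -∫ x, inner ℝ (grad f x) (φ x) := by
        rw [Finset.sum_neg_distrib, ← integral_finsetSum _ fun i _ => hint2 i]
        simp only [inner_grad, fderiv_apply_eq_sum f _ (φ _)]

lemma IsTestField.integral_le_totalVariation {u : Space d → ℝ} {φ : Space d → Space d}
    (hφ : IsTestField φ) : ENNReal.ofReal (∫ x, u x * divergence φ x) ≤ totalVariation u :=
  le_iSup₂ (f := fun (φ : Space d → Space d) (_ : IsTestField φ) =>
    ENNReal.ofReal (∫ x, u x * divergence φ x)) φ hφ

lemma IsTestField.neg {φ : Space d → Space d} (hφ : IsTestField φ) :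
    IsTestField fun x => -φ x :=
  ⟨hφ.contDiff.neg, hφ.hasCompactSupport.comp_left (g := fun v => -v) (by simp),
    fun x => by simpa using hφ.norm_le_one x⟩

/-- Pairing a vector g with g / √(|g|² + η²), a smooth substitute for g/|g|, loses at most η against
|g|. -/
lemma sub_le_sq_div_sqrt {a η : ℝ} (ha : 0 ≤ a) (hη : 0 < η) :
    a - η ≤ (√(a ^ 2 + η ^ 2))⁻¹ * a ^ 2 := by
  have h1 : √(a ^ 2 + η ^ 2) ≤ a + η := by
    rw [Real.sqrt_le_left (by positivity)]
    nlinarith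
  have h0 : 0 < √(a ^ 2 + η ^ 2) := by positivity
  rw [inv_mul_eq_div, le_div_iff₀ h0]
  rcases le_total a η with h | h
  · nlinarith
  · nlinarith

/-- A regularised normalisation of a compactly supported vector field is a test field. -/
lemma isTestField_smul_of_contDiff {g : Space d → Space d} (hg : ContDiff ℝ 1 g)
    (hgc : HasCompactSupport g) {η : ℝ} (hη : 0 < η) :
    IsTestField fun x => (√(‖g x‖ ^ 2 + η ^ 2))⁻¹ • g x := by
  have hpos : ∀ x, 0 < ‖g x‖ ^ 2 + η ^ 2 := fun x => by positivity
  have hw : ContDiff ℝ 1 fun x => √(‖g x‖ ^ 2 + η ^ 2) :=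
    ((hg.norm_sq ℝ).add contDiff_const).sqrt fun x => (hpos x).ne'
  refine ⟨(hw.inv fun x => (Real.sqrt_pos.2 (hpos x)).ne').smul hg, ?_, fun x => ?_⟩
  · refine hgc.mono fun x hx => ?_
    contrapose! hx
    rw [Function.notMem_support] at hx ⊢
    rw [hx, smul_zero]
  · rw [norm_smul, Real.norm_of_nonneg (by positivity), inv_mul_eq_div]
    refine div_le_one_of_le₀ ?_ (by positivity)
    exact Real.le_sqrt_of_sq_le (by nlinarith)

/-- For smooth functions, the total variation controls the integral of the gradient. -/
lemma ofReal_integral_norm_grad_le {f : Space d → ℝ} (hf : ContDiff ℝ 2 f)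
    (hfc : HasCompactSupport f) :
    ENNReal.ofReal (∫ x, ‖grad f x‖) ≤ totalVariation f := by
  have hf1 : ContDiff ℝ 1 f := hf.of_le (by norm_num)
  have hg : ContDiff ℝ 1 (grad f) := contDiff_grad (n := 1) (by exact_mod_cast hf)
  have hgc := hasCompactSupport_grad hfc
  set K := tsupport f with hK
  have hKm : MeasurableSet K := (isClosed_tsupport f).measurableSet
  have hKfin : volume K ≠ ∞ := hfc.isCompact.measure_lt_top.ne
  -- The test field is the regularised -∇f/|∇f|; it is C¹ because f is C². The loss of η occurs only
  -- on the support K of f, so it vanishes as η → 0.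
  have key : ∀ η : ℝ, 0 < η →
      ENNReal.ofReal ((∫ x, ‖grad f x‖) - η * volume.real K) ≤ totalVariation f := by
    intro η hη
    have hφ := isTestField_smul_of_contDiff hg hgc hη
    refine le_trans ?_ hφ.neg.integral_le_totalVariation
    apply ENNReal.ofReal_le_ofReal
    rw [integral_mul_divergence hf1 hφ.neg.contDiff hφ.neg.hasCompactSupport]
    have hi1 : Integrable fun x => ‖grad f x‖ :=
      hg.continuous.norm.integrable_of_hasCompactSupport hgc.norm
    have hi2 : Integrable (K.indicator fun _ => η) :=
      (integrableOn_const hKfin).integrable_indicator hKm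
    have e : η * volume.real K = ∫ x, K.indicator (fun _ => η) x := by
      rw [integral_indicator_const _ hKm, smul_eq_mul, mul_comm]
    rw [e, ← integral_sub hi1 hi2, ← integral_neg]
    refine integral_mono (hi1.sub hi2) ?_ fun x => ?_
    · refine Continuous.integrable_of_hasCompactSupport ?_ ?_
      · exact (hg.continuous.inner hφ.neg.contDiff.continuous).neg
      · refine hgc.mono fun x hx => ?_
        contrapose! hx
        rw [Function.notMem_support] at hx ⊢
        simp [hx]
    · simp only [inner_neg_right, neg_neg, inner_smul_right, real_inner_self_eq_norm_sq]
      by_cases hx : x ∈ K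
      · simpa [hx] using sub_le_sq_div_sqrt (norm_nonneg (grad f x)) hη
      · simp [hx, grad_eq_zero_of_notMem_tsupport hx]
  have hlim : Filter.Tendsto
      (fun η : ℝ => ENNReal.ofReal ((∫ x, ‖grad f x‖) - η * volume.real K)) (𝓝[>] 0)
      (𝓝 (ENNReal.ofReal (∫ x, ‖grad f x‖))) := by
    have : Continuous fun η : ℝ =>
        ENNReal.ofReal ((∫ x, ‖grad f x‖) - η * volume.real K) :=
      ENNReal.continuous_ofReal.comp (by fun_prop)
    simpa using (this.tendsto 0).mono_left nhdsWithin_le_nhds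
  exact le_of_tendsto hlim (eventually_mem_nhdsWithin.mono key)

/-- The isoperimetric inequality for smooth functions, in integrated form. -/
lemma mul_lintegral_min_le_lintegral_grad (hd : 1 ≤ d) {f : Space d → ℝ} (hf : ContDiff ℝ 1 f)
    (hfc : HasCompactSupport f) (hf0 : ∀ x, 0 ≤ f x) {r : ℝ} (hr : 0 < r) :
    ENNReal.ofReal (d / r) * ∫⁻ t in Ioi (0 : ℝ),
      min (volume {x | t < f x}) (volume (Metric.ball (0 : Space d) r)) ≤
    ENNReal.ofReal (∫ x, ‖grad f x‖) := by
  set I := ∫⁻ t in Ioi (0 : ℝ),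
    min (volume {x | t < f x}) (volume (Metric.ball (0 : Space d) r))
  have hg := continuous_grad hf
  have hgc := hasCompactSupport_grad hfc
  -- Since ε ≤ 1 below, K contains the ε-neighbourhood of every positive superlevel set. Its finite
  -- volume makes the error term ω|K| vanish in the limit.
  set K := Metric.cthickening 1 (tsupport f) with hK
  have hKc : IsCompact K := hfc.isCompact.cthickening
  have hKm : MeasurableSet K := hKc.measurableSet
  have hfint : Integrable f := hf.continuous.integrable_of_hasCompactSupport hfc
  have hgint : Integrable fun x => ‖grad f x‖ :=
    hg.norm.integrable_of_hasCompactSupport hgc.norm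
  have key : ∀ ω : ℝ, 0 < ω →
      ENNReal.ofReal (d / r) * I ≤
        ENNReal.ofReal (∫ x, ‖grad f x‖) + ENNReal.ofReal ω * volume K := by
    intro ω hω
    obtain ⟨ε₀, hε₀, huc⟩ :=
      Metric.uniformContinuous_iff.1 (hgc.uniformContinuous_of_continuous hg) ω hω
    set ε := min ε₀ 1 with hεdef
    have hε : 0 < ε := lt_min hε₀ one_pos
    -- Here ω bounds the oscillation of ∇f at scale ε. By the mean value inequality f(x) ≤ G(x + y)
    -- for x in the support of f and |y| < ε, so {f > t} + B_ε ⊆ {G > t}.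
    let G : Space d → ℝ := fun x => f x + (ε * ‖grad f x‖ + K.indicator (fun _ => ε * ω) x)
    have hGm : Measurable G := by
      refine hf.continuous.measurable.add ((hg.norm.measurable.const_mul ε).add ?_)
      exact measurable_const.indicator hKm
    have hind0 : ∀ x, 0 ≤ K.indicator (fun _ => ε * ω) x := fun x =>
      indicator_nonneg (fun _ _ => by positivity) x
    have hG0 : ∀ x, 0 ≤ G x := fun x =>
      add_nonneg (hf0 x) (add_nonneg (by positivity) (hind0 x))
    have hincl : ∀ t ∈ Ioi (0 : ℝ), ∀ x ∈ {x | t < f x}, ∀ y ∈ Metric.ball (0 : Space d) ε,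
        x + y ∈ {x | t < G x} := by
      intro t ht x hx y hy
      simp only [mem_ofPred_eq] at hx ⊢
      rw [mem_ball_zero_iff] at hy
      have hxs : x ∈ tsupport f := subset_tsupport f (ne_of_gt (lt_trans ht hx))
      have hzK : x + y ∈ K := by
        refine Metric.mem_cthickening_of_dist_le _ x _ _ hxs ?_
        simpa [dist_eq_norm] using hy.le.trans (min_le_right _ _)
      have hbound : ∀ w ∈ Metric.ball (x + y) ε, ‖fderiv ℝ f w‖ ≤ ‖grad f (x + y)‖ + ω := by
        intro w hw
        have h1 := huc (lt_of_lt_of_le hw (min_le_left _ _))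
        rw [dist_eq_norm] at h1
        have h2 := norm_sub_norm_le (grad f w) (grad f (x + y))
        have h3 := norm_fderiv_le_norm_grad f w
        linarith
      have hmvt := (convex_ball (x + y) ε).norm_image_sub_le_of_norm_fderiv_le (𝕜 := ℝ)
        (fun w _ => hf.differentiable one_ne_zero w) hbound (Metric.mem_ball_self hε)
        (y := x) (by simpa [dist_eq_norm] using hy)
      have h4 : f x - f (x + y) ≤ (‖grad f (x + y)‖ + ω) * ε := by
        refine (le_abs_self _).trans (hmvt.trans ?_)
        gcongr
        simpa using hy.le
      simp only [G, indicator_of_mem hzK]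
      nlinarith
    have hlevel : ∀ t ∈ Ioi (0 : ℝ), volume {x | t < f x} + ENNReal.ofReal (ε * (d / r)) *
        min (volume {x | t < f x}) (volume (Metric.ball (0 : Space d) r)) ≤
        volume {x | t < G x} := by
      intro t ht
      refine volume_add_mul_min_le hd (measurableSet_lt measurable_const hf.continuous.measurable)
        (measurableSet_lt measurable_const hGm) ?_ hr hε (hincl t ht)
      refine ne_top_of_le_ne_top hfc.isCompact.measure_lt_top.ne (measure_mono fun x hx => ?_)
      exact subset_tsupport f (ne_of_gt (lt_trans ht hx))
    have hmeas : Measurable fun t : ℝ => volume {x | t < f x} :=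
      Antitone.measurable fun s t hst => measure_mono fun x hx => lt_of_le_of_lt hst hx
    have hfl : ∫⁻ x, ENNReal.ofReal (f x) = ∫⁻ t in Ioi (0 : ℝ), volume {x | t < f x} :=
      lintegral_eq_lintegral_meas_lt _ (Filter.Eventually.of_forall hf0)
        hf.continuous.measurable.aemeasurable
    have hGl : ∫⁻ x, ENNReal.ofReal (G x) = ∫⁻ t in Ioi (0 : ℝ), volume {x | t < G x} :=
      lintegral_eq_lintegral_meas_lt _ (Filter.Eventually.of_forall hG0) hGm.aemeasurable
    -- The level-wise volume gain, integrated in t. After the finite ∫ f is cancelled against the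
    -- same term of ∫ G, every remaining term carries a factor ε.
    have h1 : (∫⁻ x, ENNReal.ofReal (f x)) + ENNReal.ofReal (ε * (d / r)) * I ≤
        ∫⁻ x, ENNReal.ofReal (G x) := by
      rw [hfl, hGl, ← lintegral_const_mul _ (hmeas.min measurable_const),
        ← lintegral_add_left hmeas]
      exact setLIntegral_mono' measurableSet_Ioi hlevel
    have h2 : ∫⁻ x, ENNReal.ofReal (G x) = (∫⁻ x, ENNReal.ofReal (f x)) +
        (ENNReal.ofReal ε * ENNReal.ofReal (∫ x, ‖grad f x‖) +
          ENNReal.ofReal (ε * ω) * volume K) := by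
      have e : ∀ x, ENNReal.ofReal (G x) = ENNReal.ofReal (f x) +
          (ENNReal.ofReal ε * ENNReal.ofReal ‖grad f x‖ +
            K.indicator (fun _ => ENNReal.ofReal (ε * ω)) x) := by
        intro x
        rw [ENNReal.ofReal_add (hf0 x) (add_nonneg (by positivity) (hind0 x)),
          ENNReal.ofReal_add (by positivity) (hind0 x), ENNReal.ofReal_mul hε.le]
        congr 2
        by_cases hx : x ∈ K <;> simp [hx]
      simp only [e]
      rw [lintegral_add_left hf.continuous.measurable.ennreal_ofReal,
        lintegral_add_left (hg.norm.measurable.ennreal_ofReal.const_mul _),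
        lintegral_const_mul _ hg.norm.measurable.ennreal_ofReal,
        lintegral_indicator_const hKm,
        ofReal_integral_eq_lintegral_ofReal hgint
          (Filter.Eventually.of_forall fun x => norm_nonneg _)]
    have hfin : ∫⁻ x, ENNReal.ofReal (f x) ≠ ∞ := by
      rw [← ofReal_integral_eq_lintegral_ofReal hfint (Filter.Eventually.of_forall hf0)]
      exact ENNReal.ofReal_ne_top
    rw [h2] at h1
    have h3 := (ENNReal.add_le_add_iff_left hfin).1 h1
    rw [ENNReal.ofReal_mul hε.le, ENNReal.ofReal_mul hε.le, mul_assoc, mul_assoc, ← mul_add] at h3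
    exact (ENNReal.mul_le_mul_iff_right (by simpa using hε) ENNReal.ofReal_ne_top).1 h3
  have hlim : Filter.Tendsto (fun ω : ℝ =>
      ENNReal.ofReal (∫ x, ‖grad f x‖) + ENNReal.ofReal ω * volume K) (𝓝[>] 0)
      (𝓝 (ENNReal.ofReal (∫ x, ‖grad f x‖) + ENNReal.ofReal 0 * volume K)) := by
    refine Filter.Tendsto.mono_left ?_ nhdsWithin_le_nhds
    refine tendsto_const_nhds.add (ENNReal.Tendsto.mul_const ?_ (Or.inr hKc.measure_lt_top.ne))
    exact ENNReal.continuous_ofReal.tendsto 0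
  simpa using ge_of_tendsto hlim (eventually_mem_nhdsWithin.mono key)

end Gradient

/-! ### Mollification and total variation. -/

section Mollification

variable {d : ℕ}

/-- The derivatives fall on φ, and integration against the scalar kernel commutes with taking
coordinates. Moving a mollifier from u to the test field therefore stays within divergences. -/
lemma divergence_convolution (ρ : ContDiffBump (0 : Space d)) {φ : Space d → Space d}
    (hφ : ContDiff ℝ 1 φ) (hφc : HasCompactSupport φ) (x : Space d) :
    divergence (ρ.normed volume ⋆[lsmul ℝ ℝ, volume] φ) x =
      (ρ.normed volume ⋆[lsmul ℝ ℝ, volume] divergence φ) x := by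
  have hρ : LocallyIntegrable (ρ.normed volume) (volume : Measure (Space d)) :=
    ρ.integrable_normed.locallyIntegrable
  have hd : Continuous fun y => fderiv ℝ φ y := hφ.continuous_fderiv one_ne_zero
  have hint : ∀ i : Fin d, Integrable fun t =>
      ρ.normed volume t • fderiv ℝ φ (x - t) (EuclideanSpace.single i (1 : ℝ)) := fun i =>
    ((ρ.continuous_normed).smul ((hd.comp (continuous_const.sub continuous_id)).clm_apply
      continuous_const)).integrable_of_hasCompactSupport ρ.hasCompactSupport_normed.smul_right
  have hcoord : ∀ i : Fin d,
      fderiv ℝ (ρ.normed volume ⋆[lsmul ℝ ℝ, volume] φ) x (EuclideanSpace.single i (1 : ℝ)) i =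
        ∫ t, ρ.normed volume t * fderiv ℝ φ (x - t) (EuclideanSpace.single i (1 : ℝ)) i := by
    intro i
    rw [(hφc.hasFDerivAt_convolution_right (lsmul ℝ ℝ) hρ hφ x).fderiv,
      convolution_precompR_apply _ hρ (hφc.fderiv ℝ) hd, convolution_def]
    exact ((EuclideanSpace.proj (𝕜 := ℝ) i).integral_comp_comm (hint i)).symm
  have hint' : ∀ i : Fin d, Integrable fun t =>
      ρ.normed volume t * fderiv ℝ φ (x - t) (EuclideanSpace.single i (1 : ℝ)) i := fun i =>
    (EuclideanSpace.proj (𝕜 := ℝ) i).integrable_comp (hint i)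
  rw [convolution_def]
  simp only [divergence, hcoord, ContinuousLinearMap.lsmul_apply, smul_eq_mul, Finset.mul_sum]
  rw [integral_finsetSum _ fun i _ => hint' i]

/-- The mollified field is an average of φ against a probability density, so the bound by 1
survives. -/
lemma IsTestField.convolution (ρ : ContDiffBump (0 : Space d)) {φ : Space d → Space d}
    (hφ : IsTestField φ) : IsTestField (ρ.normed volume ⋆[lsmul ℝ ℝ, volume] φ) := by
  refine ⟨?_, ρ.hasCompactSupport_normed.convolution _ hφ.hasCompactSupport, fun x => ?_⟩
  · exact_mod_cast hφ.hasCompactSupport.contDiff_convolution_right (n := 1) (lsmul ℝ ℝ)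
      ρ.integrable_normed.locallyIntegrable (by exact_mod_cast hφ.contDiff)
  · rw [convolution_def]
    refine (norm_integral_le_of_norm_le (ρ.integrable_normed (μ := volume))
      (Filter.Eventually.of_forall fun t => ?_)).trans_eq ρ.integral_normed
    rw [ContinuousLinearMap.lsmul_apply, norm_smul, Real.norm_of_nonneg (ρ.nonneg_normed t)]
    exact mul_le_of_le_one_right (ρ.nonneg_normed t) (hφ.norm_le_one _)

/-- Convolution with an even kernel is symmetric. -/
lemma integral_convolution_mul (ρ : ContDiffBump (0 : Space d)) {u D : Space d → ℝ}
    (hu : Integrable u) (hD : Continuous D) (hDc : HasCompactSupport D) :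
    ∫ x, (ρ.normed volume ⋆[lsmul ℝ ℝ, volume] u) x * D x =
      ∫ x, u x * (ρ.normed volume ⋆[lsmul ℝ ℝ, volume] D) x := by
  obtain ⟨C, hC⟩ := hD.bounded_above_of_compact_support hDc
  have hprod : Integrable (fun p : Space d × Space d =>
      (u p.2 * ρ.normed volume (p.1 - p.2)) * D p.1) (volume.prod volume) :=
    (hu.convolution_integrand (lsmul ℝ ℝ) (ρ.integrable_normed (μ := volume))).mul_bdd (c := C)
      (hD.comp continuous_fst).aestronglyMeasurable (Filter.Eventually.of_forall fun p => hC p.1)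
  calc ∫ x, (ρ.normed volume ⋆[lsmul ℝ ℝ, volume] u) x * D x
      = ∫ x, ∫ t, (u t * ρ.normed volume (x - t)) * D x := by
        refine integral_congr_ae (Filter.Eventually.of_forall fun x => ?_)
        simp only [convolution_eq_swap, ContinuousLinearMap.lsmul_apply, smul_eq_mul]
        rw [← integral_mul_const]
        simp only [mul_comm]
    _ = ∫ t, ∫ x, (u t * ρ.normed volume (x - t)) * D x := integral_integral_swap hprod
    _ = ∫ x, u x * (ρ.normed volume ⋆[lsmul ℝ ℝ, volume] D) x := by
        refine integral_congr_ae (Filter.Eventually.of_forall fun t => ?_)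
        simp only [convolution_eq_swap, ContinuousLinearMap.lsmul_apply, smul_eq_mul]
        rw [← integral_const_mul]
        refine integral_congr_ae (Filter.Eventually.of_forall fun x => ?_)
        have : ρ.normed volume (x - t) = ρ.normed volume (t - x) := by
          rw [← ρ.normed_neg, neg_sub]
        simp only [this, mul_assoc]

/-- Mollification does not increase the total variation. -/
lemma totalVariation_convolution_le (ρ : ContDiffBump (0 : Space d)) {u : Space d → ℝ}
    (hu : Integrable u) :
    totalVariation (ρ.normed volume ⋆[lsmul ℝ ℝ, volume] u) ≤ totalVariation u := by
  refine iSup₂_le fun φ hφ => ?_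
  rw [integral_convolution_mul ρ hu (continuous_divergence hφ.contDiff)
    (hasCompactSupport_divergence hφ.hasCompactSupport)]
  simp only [← divergence_convolution ρ hφ.contDiff hφ.hasCompactSupport]
  exact (hφ.convolution ρ).integral_le_totalVariation

/-- Scheffé's lemma. -/
lemma tendsto_integral_norm_sub_of_tendsto_ae {α : Type*} [MeasurableSpace α] {μ : Measure α}
    {f : ℕ → α → ℝ} {u : α → ℝ} (hf : ∀ n, Integrable (f n) μ) (hu : Integrable u μ)
    (hf0 : ∀ n x, 0 ≤ f n x) (hint : ∀ n, ∫ x, f n x ∂μ = ∫ x, u x ∂μ)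
    (hlim : ∀ᵐ x ∂μ, Filter.Tendsto (fun n => f n x) Filter.atTop (𝓝 (u x))) :
    Filter.Tendsto (fun n => ∫ x, ‖f n x - u x‖ ∂μ) Filter.atTop (𝓝 0) := by
  -- Only (u - f_n)⁺ is dominated, by |u|, because f_n ≥ 0. Equality of the integrals makes ∫ |f_n -
  -- u| twice its integral.
  have h1 : Filter.Tendsto (fun n => ∫ x, max (u x - f n x) 0 ∂μ) Filter.atTop
      (𝓝 (∫ _, (0 : ℝ) ∂μ)) := by
    refine tendsto_integral_of_dominated_convergence (fun x => ‖u x‖)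
      (fun n => ((hu.sub (hf n)).pos_part).aestronglyMeasurable) hu.norm (fun n => ?_) ?_
    · refine Filter.Eventually.of_forall fun x => ?_
      rw [Real.norm_of_nonneg (le_max_right _ _)]
      refine max_le ?_ (norm_nonneg _)
      have := hf0 n x
      have := Real.le_norm_self (u x)
      linarith
    · filter_upwards [hlim] with x hx
      simpa using (tendsto_const_nhds (x := u x)).sub hx |>.max (tendsto_const_nhds (x := (0 : ℝ)))
  have h2 : ∀ n, ∫ x, ‖f n x - u x‖ ∂μ = 2 * ∫ x, max (u x - f n x) 0 ∂μ := by
    intro n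
    have e : ∀ x, ‖f n x - u x‖ = 2 * max (u x - f n x) 0 + (f n x - u x) := by
      intro x
      rcases le_total (u x) (f n x) with h | h
      · rw [max_eq_right (by linarith), Real.norm_of_nonneg (by linarith)]; ring
      · rw [max_eq_left (by linarith), Real.norm_of_nonpos (by linarith)]; ring
    simp only [e]
    have hi1 : Integrable (fun x => 2 * max (u x - f n x) 0) μ :=
      (hu.sub (hf n)).pos_part.const_mul 2
    have hi2 : Integrable (fun x => f n x - u x) μ := (hf n).sub hu
    rw [integral_add hi1 hi2, integral_const_mul, integral_sub (hf n) hu, hint n, sub_self, add_zero]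
  simp only [h2]
  simpa using h1.const_mul 2

/-- Smooth approximation of nonnegative integrable functions, with control of the total
variation. -/
lemma exists_smooth_approximation {u : Space d → ℝ} (hu : Integrable u)
    (huc : HasCompactSupport u) (hu0 : ∀ x, 0 ≤ u x) :
    ∃ f : ℕ → Space d → ℝ, (∀ n, ContDiff ℝ 2 (f n)) ∧ (∀ n, HasCompactSupport (f n)) ∧
      (∀ n x, 0 ≤ f n x) ∧ (∀ n, totalVariation (f n) ≤ totalVariation u) ∧
      (∀ᵐ x, Filter.Tendsto (fun n => f n x) Filter.atTop (𝓝 (u x))) ∧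
      Filter.Tendsto (fun n => ∫ x, ‖f n x - u x‖) Filter.atTop (𝓝 0) := by
  -- The ratio of outer to inner radius is kept equal to 2; the a.e. convergence theorem needs it
  -- bounded.
  let ρ : ℕ → ContDiffBump (0 : Space d) := fun n =>
    ⟨1 / ((n : ℝ) + 1), 2 * (1 / ((n : ℝ) + 1)), by positivity,
      by linarith [show 0 < 1 / ((n : ℝ) + 1) by positivity]⟩
  let f : ℕ → Space d → ℝ := fun n => (ρ n).normed volume ⋆[lsmul ℝ ℝ, volume] u
  have hrout : Filter.Tendsto (fun n => (ρ n).rOut) Filter.atTop (𝓝 0) := by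
    have := (tendsto_one_div_add_atTop_nhds_zero_nat (𝕜 := ℝ)).const_mul 2
    rwa [mul_zero] at this
  have hae : ∀ᵐ x, Filter.Tendsto (fun n => f n x) Filter.atTop (𝓝 (u x)) :=
    ContDiffBump.ae_convolution_tendsto_right_of_locallyIntegrable (K := 2) hrout
      (Filter.Eventually.of_forall fun n => le_rfl) hu.locallyIntegrable
  have hf0 : ∀ n x, 0 ≤ f n x := by
    intro n x
    refine integral_nonneg fun t => ?_
    exact mul_nonneg ((ρ n).nonneg_normed t) (hu0 _)
  refine ⟨f, fun n => ?_, fun n => (ρ n).hasCompactSupport_normed.convolution _ huc, hf0,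
    fun n => totalVariation_convolution_le (ρ n) hu, hae, ?_⟩
  · exact_mod_cast (ρ n).hasCompactSupport_normed.contDiff_convolution_left (n := 2) (lsmul ℝ ℝ)
      (ρ n).contDiff_normed hu.locallyIntegrable
  · refine tendsto_integral_norm_sub_of_tendsto_ae
      (fun n => (ρ n).integrable_normed.integrable_convolution _ hu) hu hf0 (fun n => ?_) hae
    rw [integral_convolution _ (ρ n).integrable_normed hu, (ρ n).integral_normed]
    simp

end Mollification

/-! ### The Cheeger–Faber–Krahn inequality. -/

section Isoperimetric

variable {d : ℕ}

/-- Measures of superlevel sets are lower semicontinuous under almost everywhere convergence. -/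
lemma measure_lt_le_liminf {α : Type*} [MeasurableSpace α] {μ : Measure α} {f : ℕ → α → ℝ}
    {u : α → ℝ} (hf : ∀ n, Measurable (f n))
    (hlim : ∀ᵐ x ∂μ, Filter.Tendsto (fun n => f n x) Filter.atTop (𝓝 (u x))) (t : ℝ) :
    μ {x | t < u x} ≤ Filter.liminf (fun n => μ {x | t < f n x}) Filter.atTop := by
  have hm : ∀ n, MeasurableSet {x | t < f n x} := fun n => measurableSet_lt measurable_const (hf n)
  let g : ℕ → α → ℝ≥0∞ := fun n => {x | t < f n x}.indicator 1
  have hg : ∀ n, Measurable (g n) := fun n => measurable_one.indicator (hm n)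
  -- Where u > t, eventually f_n > t, so the indicators have liminf at least 1; Markov's inequality
  -- and Fatou's lemma conclude.
  calc μ {x | t < u x} ≤ μ {x | 1 ≤ Filter.liminf (fun n => g n x) Filter.atTop} := by
        refine measure_mono_ae ?_
        filter_upwards [hlim] with x hx hxt
        refine Filter.le_liminf_of_le (by isBoundedDefault) ?_
        filter_upwards [hx.eventually_const_lt hxt] with n hn
        simp [g, hn]
    _ ≤ ∫⁻ x, Filter.liminf (fun n => g n x) Filter.atTop ∂μ := by
        simpa using mul_meas_ge_le_lintegral₀ (μ := μ)
          (Measurable.liminf hg).aemeasurable (1 : ℝ≥0∞)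
    _ ≤ Filter.liminf (fun n => ∫⁻ x, g n x ∂μ) Filter.atTop := lintegral_liminf_le hg
    _ = Filter.liminf (fun n => μ {x | t < f n x}) Filter.atTop := by
        simp only [g, lintegral_indicator_one (hm _)]

/-- The Cheeger–Faber–Krahn inequality: the total variation of a nonnegative function supported
on a set no larger than a ball of radius `r` is at least `d / r` times its integral. -/
lemma mul_lintegral_le_totalVariation (hd : 1 ≤ d) {u : Space d → ℝ} (hu : Integrable u)
    (huc : HasCompactSupport u) (hu0 : ∀ x, 0 ≤ u x) {r : ℝ} (hr : 0 < r)
    (hvol : volume {x | 0 < u x} ≤ volume (Metric.ball (0 : Space d) r)) :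
    ENNReal.ofReal (d / r) * ∫⁻ x, ENNReal.ofReal (u x) ≤ totalVariation u := by
  obtain ⟨f, hf, hfc, hf0, hTV, hae, -⟩ := exists_smooth_approximation hu huc hu0
  set β := volume (Metric.ball (0 : Space d) r)
  have hmeas : ∀ n, Measurable fun t : ℝ => min (volume {x | t < f n x}) β := fun n =>
    Measurable.min (Antitone.measurable fun s t hst =>
      measure_mono fun x hx => lt_of_le_of_lt hst hx) measurable_const
  -- Mollification may enlarge the superlevel sets beyond β, but in the limit the cap is harmless
  -- since {u > t} ⊆ {u > 0} has measure at most β.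
  have hlevel : ∀ t ∈ Ioi (0 : ℝ), volume {x | t < u x} ≤
      Filter.liminf (fun n => min (volume {x | t < f n x}) β) Filter.atTop := by
    intro t ht
    refine le_of_forall_lt fun b hb => ?_
    obtain ⟨c, hbc, hc⟩ := exists_between hb
    refine hbc.trans_le (Filter.le_liminf_of_le (by isBoundedDefault) ?_)
    have h1 := Filter.eventually_lt_of_lt_liminf (hc.trans_le
      (measure_lt_le_liminf (fun n => (hf n).continuous.measurable) hae t))
    have hsub : {x | t < u x} ⊆ {x | 0 < u x} := fun x hx => lt_trans (mem_Ioi.1 ht) hx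
    have h2 : c < β := hc.trans_le ((measure_mono hsub).trans hvol)
    filter_upwards [h1] with n hn
    exact le_min hn.le h2.le
  have h1 : ∫⁻ x, ENNReal.ofReal (u x) ≤
      Filter.liminf (fun n => ∫⁻ t in Ioi (0 : ℝ), min (volume {x | t < f n x}) β)
        Filter.atTop := by
    rw [lintegral_eq_lintegral_meas_lt _ (Filter.Eventually.of_forall hu0) hu.aemeasurable]
    exact (setLIntegral_mono' measurableSet_Ioi hlevel).trans (lintegral_liminf_le hmeas)
  have hpos : ENNReal.ofReal (d / r) ≠ 0 := by
    have : (0 : ℝ) < d := by exact_mod_cast hd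
    simp only [ne_eq, ENNReal.ofReal_eq_zero, not_le]
    positivity
  rw [mul_comm, ← ENNReal.le_div_iff_mul_le (Or.inl hpos) (Or.inl ENNReal.ofReal_ne_top)]
  refine h1.trans (Filter.liminf_le_of_frequently_le' (Filter.Frequently.of_forall fun n => ?_))
  rw [ENNReal.le_div_iff_mul_le (Or.inl hpos) (Or.inl ENNReal.ofReal_ne_top), mul_comm]
  exact (mul_lintegral_min_le_lintegral_grad hd ((hf n).of_le (by norm_num)) (hfc n) (hf0 n)
    hr).trans ((ofReal_integral_norm_grad_le (hf n) (hfc n)).trans (hTV n))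

end Isoperimetric

/-! ### Splitting the total variation by truncation. -/

section Truncation

variable {d : ℕ}

lemma isTestField_zero : IsTestField (fun _ : Space d => (0 : Space d)) :=
  ⟨contDiff_const, HasCompactSupport.zero, by simp⟩

lemma divergence_zero (x : Space d) : divergence (fun _ : Space d => (0 : Space d)) x = 0 := by
  simp [divergence]

lemma grad_comp {f : Space d → ℝ} {a : ℝ → ℝ} {x : Space d} (hf : DifferentiableAt ℝ f x)
    (ha : DifferentiableAt ℝ a (f x)) :
    grad (fun y => a (f y)) x = deriv a (f x) • grad f x := by
  have h : HasFDerivAt (fun y => a (f y)) _ x :=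
    ha.hasDerivAt.comp_hasFDerivAt x hf.hasFDerivAt
  ext i
  simp [grad, h.fderiv]

lemma grad_sub {f g : Space d → ℝ} {x : Space d} (hf : DifferentiableAt ℝ f x)
    (hg : DifferentiableAt ℝ g x) : grad (fun y => f y - g y) x = grad f x - grad g x := by
  have h : HasFDerivAt (fun y => f y - g y) _ x := hf.hasFDerivAt.sub hg.hasFDerivAt
  ext i
  simp [grad, h.fderiv]

lemma norm_convex_combination_le {s : ℝ} (hs : s ∈ Icc (0 : ℝ) 1) {v w : Space d} (hv : ‖v‖ ≤ 1)
    (hw : ‖w‖ ≤ 1) : ‖s • v + (1 - s) • w‖ ≤ 1 := by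
  refine (norm_add_le _ _).trans ?_
  rw [norm_smul, norm_smul, Real.norm_of_nonneg hs.1, Real.norm_of_nonneg (by linarith [hs.2])]
  nlinarith [hs.1, hs.2]

/-- Decomposing a smooth function monotonically does not increase the total variation. -/
lemma ofReal_integral_comp_add_le {f : Space d → ℝ} (hf : ContDiff ℝ 1 f) {a : ℝ → ℝ}
    (ha : ContDiff ℝ 2 a) (ha' : ∀ s, deriv a s ∈ Icc (0 : ℝ) 1) {φ ψ : Space d → Space d}
    (hφ : IsTestField φ) (hψ : IsTestField ψ) :
    ENNReal.ofReal ((∫ x, a (f x) * divergence φ x) +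
      ∫ x, (f x - a (f x)) * divergence ψ x) ≤ totalVariation f := by
  have ha1 : ContDiff ℝ 1 a := ha.of_le (by norm_num)
  have hda : ContDiff ℝ 1 (deriv a) :=
    (contDiff_succ_iff_deriv (n := 1).1 (by exact_mod_cast ha)).2.2
  have haf : ContDiff ℝ 1 fun x => a (f x) := ha1.comp hf
  have hdaf : ContDiff ℝ 1 fun x => deriv a (f x) := hda.comp hf
  have hfd : ∀ x, DifferentiableAt ℝ f x := hf.differentiable one_ne_zero
  have had : ∀ s, DifferentiableAt ℝ a s := ha1.differentiable one_ne_zero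
  -- As a' takes values in [0, 1], this pointwise convex combination is a single test field for f.
  -- Its pairing with ∇f is that of φ with ∇(a ∘ f) plus that of ψ with ∇(f - a ∘ f).
  have hθ : IsTestField fun x => deriv a (f x) • φ x + (1 - deriv a (f x)) • ψ x := by
    refine ⟨(hdaf.smul hφ.contDiff).add ((contDiff_const.sub hdaf).smul hψ.contDiff), ?_,
      fun x => norm_convex_combination_le (ha' _) (hφ.norm_le_one x) (hψ.norm_le_one x)⟩
    exact (hφ.hasCompactSupport.smul_left (f := fun x => deriv a (f x))).add
      (hψ.hasCompactSupport.smul_left (f := fun x => 1 - deriv a (f x)))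
  have hg := continuous_grad hf
  have hi1 : Integrable fun x => inner ℝ (grad (fun y => a (f y)) x) (φ x) := by
    refine ((continuous_grad haf).inner hφ.contDiff.continuous).integrable_of_hasCompactSupport
      (hφ.hasCompactSupport.mono fun x hx => ?_)
    contrapose! hx
    rw [Function.notMem_support] at hx ⊢
    simp [hx]
  have hi2 : Integrable fun x => inner ℝ (grad (fun y => f y - a (f y)) x) (ψ x) := by
    refine ((continuous_grad (hf.sub haf)).inner
      hψ.contDiff.continuous).integrable_of_hasCompactSupport
      (hψ.hasCompactSupport.mono fun x hx => ?_)
    contrapose! hx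
    rw [Function.notMem_support] at hx ⊢
    simp [hx]
  refine le_trans (le_of_eq ?_) hθ.integral_le_totalVariation
  rw [integral_mul_divergence haf hφ.contDiff hφ.hasCompactSupport,
    integral_mul_divergence (hf.sub haf) hψ.contDiff hψ.hasCompactSupport,
    integral_mul_divergence hf hθ.contDiff hθ.hasCompactSupport, ← neg_add,
    ← integral_add hi1 hi2]
  congr 2
  refine integral_congr_ae (Filter.Eventually.of_forall fun x => ?_)
  have e : grad (fun y => f y - a (f y)) x = grad f x - deriv a (f x) • grad f x := by
    rw [grad_sub (hfd x) (haf.differentiable one_ne_zero x), grad_comp (hfd x) (had (f x))]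
  simp only [e, grad_comp (hfd x) (had (f x)), inner_add_right, inner_sub_left, inner_smul_left,
    inner_smul_right, conj_trivial]
  ring

/-- A smooth approximation of the positive part `(s - t)⁺`. -/
noncomputable def smoothPosPart (t η s : ℝ) : ℝ := (s - t + √((s - t) ^ 2 + η ^ 2)) / 2

lemma contDiff_smoothPosPart (t : ℝ) {η : ℝ} (hη : 0 < η) : ContDiff ℝ 2 (smoothPosPart t η) := by
  unfold smoothPosPart
  refine ((contDiff_id.sub contDiff_const).add (ContDiff.sqrt ?_ fun s => ?_)).div_const 2
  · exact ((contDiff_id.sub contDiff_const).pow 2).add contDiff_const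
  · positivity

lemma deriv_smoothPosPart_mem (t : ℝ) {η : ℝ} (hη : 0 < η) (s : ℝ) :
    deriv (smoothPosPart t η) s ∈ Icc (0 : ℝ) 1 := by
  have hpos : 0 < (s - t) ^ 2 + η ^ 2 := by positivity
  have h1 : HasDerivAt (fun s : ℝ => s - t) 1 s := (hasDerivAt_id s).sub_const t
  have h2 := ((h1.pow 2).add_const (η ^ 2)).sqrt hpos.ne'
  have h3 : HasDerivAt (smoothPosPart t η)
      ((1 + (s - t) / √((s - t) ^ 2 + η ^ 2)) / 2) s := by
    refine ((h1.add h2).div_const 2).congr_deriv ?_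
    congr 2
    simp only [Pi.pow_apply, Nat.cast_ofNat, Nat.add_one_sub_one, pow_one, mul_one]
    rw [mul_div_mul_left _ _ two_ne_zero]
  rw [h3.deriv]
  have hr : 0 < √((s - t) ^ 2 + η ^ 2) := Real.sqrt_pos.2 hpos
  have habs : |s - t| ≤ √((s - t) ^ 2 + η ^ 2) := Real.abs_le_sqrt (by nlinarith)
  have hq : |(s - t) / √((s - t) ^ 2 + η ^ 2)| ≤ 1 := by
    rw [abs_div, abs_of_pos hr]
    exact div_le_one_of_le₀ habs hr.le
  rw [abs_le] at hq
  constructor <;> linarith [hq.1, hq.2]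

lemma abs_smoothPosPart_sub_le (t : ℝ) {η : ℝ} (hη : 0 < η) (s : ℝ) :
    |smoothPosPart t η s - max (s - t) 0| ≤ η := by
  have h1 : |s - t| ≤ √((s - t) ^ 2 + η ^ 2) := Real.abs_le_sqrt (by nlinarith)
  have h2 : √((s - t) ^ 2 + η ^ 2) ≤ |s - t| + η := by
    rw [Real.sqrt_le_left (by positivity)]
    nlinarith [sq_abs (s - t), abs_nonneg (s - t)]
  unfold smoothPosPart
  rw [abs_le]
  rcases le_total t s with h | h
  · rw [max_eq_left (by linarith)]
    rw [abs_of_nonneg (by linarith)] at h1 h2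
    constructor <;> linarith
  · rw [max_eq_right (by linarith)]
    rw [abs_of_nonpos (by linarith)] at h1 h2
    constructor <;> linarith

/-- The uniform error η is integrated against the integrable |D|, and the L¹ error against a bound
for |D|. -/
lemma tendsto_integral_mul_of_norm_sub_le {f g : ℕ → Space d → ℝ} {u v D : Space d → ℝ}
    {η : ℕ → ℝ} (hg : ∀ n, Continuous (g n)) (hf : ∀ n, Integrable (f n)) (hu : Integrable u)
    (hv : Integrable v) (hD : Continuous D) (hDc : HasCompactSupport D)
    (hle : ∀ n x, |g n x - v x| ≤ η n + ‖f n x - u x‖)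
    (hη : Filter.Tendsto η Filter.atTop (𝓝 0))
    (hlim : Filter.Tendsto (fun n => ∫ x, ‖f n x - u x‖) Filter.atTop (𝓝 0)) :
    Filter.Tendsto (fun n => ∫ x, g n x * D x) Filter.atTop (𝓝 (∫ x, v x * D x)) := by
  obtain ⟨C, hC⟩ := hD.bounded_above_of_compact_support hDc
  have hig : ∀ n, Integrable fun x => g n x * D x := fun n =>
    ((hg n).mul hD).integrable_of_hasCompactSupport hDc.mul_left
  have hiv : Integrable fun x => v x * D x :=
    hv.mul_bdd (c := C) hD.aestronglyMeasurable (Filter.Eventually.of_forall hC)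
  have hiD : Integrable D := hD.integrable_of_hasCompactSupport hDc
  rw [tendsto_iff_norm_sub_tendsto_zero]
  refine squeeze_zero (g := fun n => η n * (∫ x, ‖D x‖) + (∫ x, ‖f n x - u x‖) * C)
    (fun n => norm_nonneg _) (fun n => ?_) ?_
  · have hfu : Integrable fun x => ‖f n x - u x‖ := ((hf n).sub hu).norm
    rw [← integral_sub (hig n) hiv, ← integral_const_mul, ← integral_mul_const,
      ← integral_add (hiD.norm.const_mul _) (hfu.mul_const _)]
    refine norm_integral_le_of_norm_le ((hiD.norm.const_mul _).add (hfu.mul_const _))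
      (Filter.Eventually.of_forall fun x => ?_)
    rw [← sub_mul, norm_mul, Real.norm_eq_abs]
    calc |g n x - v x| * ‖D x‖ ≤ (η n + ‖f n x - u x‖) * ‖D x‖ := by gcongr; exact hle n x
      _ = η n * ‖D x‖ + ‖f n x - u x‖ * ‖D x‖ := add_mul _ _ _
      _ ≤ η n * ‖D x‖ + ‖f n x - u x‖ * C := by gcongr; exact hC x
  · simpa using (hη.mul_const (∫ x, ‖D x‖)).add (hlim.mul_const C)

lemma integrable_posPart_sub {α : Type*} [MeasurableSpace α] {μ : Measure α} {u : α → ℝ}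
    (hu : Integrable u μ) (hu0 : ∀ x, 0 ≤ u x) {t : ℝ} (ht : 0 ≤ t) :
    Integrable (fun x => max (u x - t) 0) μ := by
  refine hu.mono ((hu.aestronglyMeasurable.sub aestronglyMeasurable_const).sup
    aestronglyMeasurable_const) (Filter.Eventually.of_forall fun x => ?_)
  rw [Real.norm_of_nonneg (le_max_right _ _), Real.norm_of_nonneg (hu0 x)]
  exact max_le (by linarith) (hu0 x)

lemma integrable_min_const {α : Type*} [MeasurableSpace α] {μ : Measure α} {u : α → ℝ}
    (hu : Integrable u μ) (hu0 : ∀ x, 0 ≤ u x) {t : ℝ} (ht : 0 ≤ t) :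
    Integrable (fun x => min (u x) t) μ := by
  refine hu.mono (hu.aestronglyMeasurable.inf aestronglyMeasurable_const)
    (Filter.Eventually.of_forall fun x => ?_)
  rw [Real.norm_of_nonneg (le_min (hu0 x) ht), Real.norm_of_nonneg (hu0 x)]
  exact min_le_left _ _

/-- Truncation splits the total variation (one half of the coarea formula). -/
lemma totalVariation_posPart_add_min_le {u : Space d → ℝ} (hu : Integrable u)
    (huc : HasCompactSupport u) (hu0 : ∀ x, 0 ≤ u x) {t : ℝ} (ht : 0 ≤ t) :
    totalVariation (fun x => max (u x - t) 0) + totalVariation (fun x => min (u x) t) ≤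
      totalVariation u := by
  obtain ⟨f, hf, hfc, hf0, hTV, -, hlim⟩ := exists_smooth_approximation hu huc hu0
  have hfi : ∀ n, Integrable (f n) := fun n =>
    (hf n).continuous.integrable_of_hasCompactSupport (hfc n)
  let η : ℕ → ℝ := fun n => 1 / ((n : ℝ) + 1)
  have hη : ∀ n, 0 < η n := fun n => by positivity
  have hη0 : Filter.Tendsto η Filter.atTop (𝓝 0) := tendsto_one_div_add_atTop_nhds_zero_nat
  let a : ℕ → ℝ → ℝ := fun n => smoothPosPart t (η n)
  have ha : ∀ n, ContDiff ℝ 2 (a n) := fun n => contDiff_smoothPosPart t (hη n)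
  have haf : ∀ n, Continuous fun x => a n (f n x) := fun n =>
    (ha n).continuous.comp (hf n).continuous
  -- The two fields are arbitrary and independent, so taking both suprema produces the sum of the
  -- two variations.
  have key : ∀ φ ψ : Space d → Space d, IsTestField φ → IsTestField ψ →
      ENNReal.ofReal ((∫ x, max (u x - t) 0 * divergence φ x) +
        ∫ x, min (u x) t * divergence ψ x) ≤ totalVariation u := by
    intro φ ψ hφ hψ
    have h1 : Filter.Tendsto (fun n => ∫ x, a n (f n x) * divergence φ x) Filter.atTop
        (𝓝 (∫ x, max (u x - t) 0 * divergence φ x)) := by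
      refine tendsto_integral_mul_of_norm_sub_le haf hfi hu (integrable_posPart_sub hu hu0 ht)
        (continuous_divergence hφ.contDiff) (hasCompactSupport_divergence hφ.hasCompactSupport)
        (fun n x => ?_) hη0 hlim
      have e1 := abs_smoothPosPart_sub_le t (hη n) (f n x)
      have e2 := abs_max_sub_max_le_abs (f n x - t) (u x - t) 0
      rw [sub_sub_sub_cancel_right] at e2
      exact (abs_sub_le _ _ _).trans (add_le_add e1 e2)
    have h2 : Filter.Tendsto (fun n => ∫ x, (f n x - a n (f n x)) * divergence ψ x) Filter.atTop
        (𝓝 (∫ x, min (u x) t * divergence ψ x)) := by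
      refine tendsto_integral_mul_of_norm_sub_le (fun n => (hf n).continuous.sub (haf n)) hfi hu
        (integrable_min_const hu hu0 ht) (continuous_divergence hψ.contDiff)
        (hasCompactSupport_divergence hψ.hasCompactSupport) (fun n x => ?_) hη0 hlim
      have e1 := abs_smoothPosPart_sub_le t (hη n) (f n x)
      have e2 := abs_min_sub_min_le_max (f n x) t (u x) t
      have e3 : min (f n x) t = f n x - max (f n x - t) 0 := by
        rcases le_total (f n x) t with h | h
        · rw [min_eq_left h, max_eq_right (by linarith), sub_zero]
        · rw [min_eq_right h, max_eq_left (by linarith), sub_sub_cancel]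
      rw [sub_self, abs_zero, max_eq_left (abs_nonneg _)] at e2
      refine (abs_sub_le _ (min (f n x) t) _).trans (add_le_add ?_ e2)
      rw [e3, sub_sub_sub_cancel_left, abs_sub_comm]
      exact e1
    refine le_of_tendsto ((ENNReal.continuous_ofReal.tendsto _).comp (h1.add h2))
      (Filter.Eventually.of_forall fun n => ?_)
    exact (ofReal_integral_comp_add_le ((hf n).of_le (by norm_num)) (ha n)
      (deriv_smoothPosPart_mem t (hη n)) hφ hψ).trans (hTV n)
  refine ENNReal.biSup_add_biSup_le' ⟨_, isTestField_zero⟩ ⟨_, isTestField_zero⟩ ?_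
  intro φ hφ ψ hψ
  -- `ENNReal.ofReal` sends negative numbers to 0, so it is additive only on nonnegative integrals.
  -- A field with nonpositive pairing is replaced by the zero field.
  rcases le_total (∫ x, max (u x - t) 0 * divergence φ x) 0 with h1 | h1
  · simpa [ENNReal.ofReal_of_nonpos h1, divergence_zero] using key _ ψ isTestField_zero hψ
  rcases le_total (∫ x, min (u x) t * divergence ψ x) 0 with h2 | h2
  · simpa [ENNReal.ofReal_of_nonpos h2, divergence_zero] using key φ _ hφ isTestField_zero
  rw [← ENNReal.ofReal_add h1 h2]
  exact key φ ψ hφ hψ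

end Truncation

/-! ### Minimality of eigenfunctions and the bound by total variation. -/

section EigenFunctions

variable {d N : ℕ}

lemma totalVariation_congr_ae {u v : Space d → ℝ} (h : u =ᵐ[volume] v) :
    totalVariation u = totalVariation v := by
  unfold totalVariation
  refine iSup_congr fun φ => iSup_congr fun _ => congrArg ENNReal.ofReal (integral_congr_ae ?_)
  filter_upwards [h] with x hx
  rw [hx]

lemma totalVariation_const_mul_le {c : ℝ} (hc : 0 ≤ c) (u : Space d → ℝ) :
    totalVariation (fun x => c * u x) ≤ ENNReal.ofReal c * totalVariation u := by
  refine iSup₂_le fun φ hφ => ?_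
  simp only [mul_assoc]
  rw [integral_const_mul, ENNReal.ofReal_mul hc]
  gcongr
  exact hφ.integral_le_totalVariation

lemma IsStrictlyIncreasing.monotone {Φ : (Fin N → ℝ≥0) → ℝ≥0} (hΦ : IsStrictlyIncreasing Φ) :
    Monotone Φ := by
  intro v w h
  by_cases hvw : ∃ i, v i < w i
  · exact (hΦ v w h hvw).le
  · push Not at hvw
    exact (congrArg Φ (funext fun i => le_antisymm (h i) (hvw i))).le

/-- Clusters induce `(1,N)`-functions with no larger energy. -/
lemma functionalEigenvalue_le_cheegerConst {Φ : (Fin N → ℝ≥0) → ℝ≥0}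
    (hΦ : IsStrictlyIncreasing Φ) {Ω : Set (Space d)} (hΩ : Bornology.IsBounded Ω) :
    functionalEigenvalue Φ Ω ≤ cheegerConst Φ Ω := by
  refine le_iInf₂ fun E hE => ?_
  have hfin : ∀ i, volume (E i) ≠ ∞ := by
    intro i
    have h1 : volume (E i) ≤ volume Ω + volume (E i \ Ω) :=
      (measure_mono (by intro x hx; by_cases h : x ∈ Ω <;> simp [h, hx])).trans
        (measure_union_le Ω (E i \ Ω))
    rw [hE.subset i, add_zero] at h1
    exact (h1.trans_lt hΩ.measure_lt_top).ne
  have hpos : ∀ i, 0 < (volume (E i)).toReal := fun i =>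
    ENNReal.toReal_pos (hE.volume_pos i).ne' (hfin i)
  -- Normalised indicators turn a cluster into a competitor whose variations are at most
  -- P(E_i)/|E_i|; monotonicity of Φ makes the inequality enough.
  let u : Fin N → Space d → ℝ := fun i x =>
    (volume (E i)).toReal⁻¹ * (E i).indicator (fun _ => (1 : ℝ)) x
  have hofReal : ∀ i, ENNReal.ofReal (volume (E i)).toReal⁻¹ = (volume (E i))⁻¹ := fun i => by
    rw [ENNReal.ofReal_inv_of_pos (hpos i), ENNReal.ofReal_toReal (hfin i)]
  have hTV : ∀ i, totalVariation (u i) ≤ perimeter (E i) / volume (E i) := by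
    intro i
    rw [ENNReal.div_eq_inv_mul, ← hofReal i]
    exact totalVariation_const_mul_le (inv_nonneg.2 (hpos i).le) _
  have hratio : ∀ i, perimeter (E i) / volume (E i) ≠ ∞ := fun i =>
    ENNReal.div_ne_top (hE.perimeter_lt_top i).ne (hE.volume_pos i).ne'
  have hu : IsNFunction Ω u := by
    refine ⟨fun i => ⟨?_, (hTV i).trans_lt (hratio i).lt_top, ?_⟩, fun i => ?_, fun i => ?_,
      fun i j hij => ?_⟩
    · exact (IntegrableOn.integrable_indicator₀ (integrableOn_const (hfin i))
        (hE.nullMeasurableSet i)).const_mul _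
    · filter_upwards [measure_eq_zero_iff_ae_notMem.1 (hE.subset i)] with x hx hxΩ
      have : x ∉ E i := fun h => hx ⟨h, hxΩ⟩
      simp [u, this]
    · refine Filter.Eventually.of_forall fun x _ => mul_nonneg (inv_nonneg.2 (hpos i).le) ?_
      exact indicator_nonneg (fun _ _ => zero_le_one) x
    · have e : u i = (E i).indicator fun _ => (volume (E i)).toReal⁻¹ := by
        ext x
        by_cases h : x ∈ E i <;> simp [u, h]
      rw [e, eLpNorm_indicator_const₀ (hE.nullMeasurableSet i) one_ne_zero ENNReal.one_ne_top,
        Real.enorm_of_nonneg (inv_nonneg.2 (hpos i).le), hofReal i]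
      simp [ENNReal.inv_mul_cancel (hE.volume_pos i).ne' (hfin i)]
    · filter_upwards [measure_eq_zero_iff_ae_notMem.1 (hE.disjoint i j hij)] with x hx _
      by_cases hi : x ∈ E i
      · have : x ∉ E j := fun h => hx ⟨hi, h⟩
        simp [u, this]
      · simp [u, hi]
  refine (iInf₂_le u hu).trans ?_
  exact_mod_cast hΦ.monotone fun i => ENNReal.toNNReal_mono (hratio i) (hTV i)

/-- Each component of an eigen-`N`-function minimises the total variation among functions
supported where it does not vanish. -/
lemma IsEigenNFunction.mul_lintegral_le {Φ : (Fin N → ℝ≥0) → ℝ≥0}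
    (hΦ : IsStrictlyIncreasing Φ) {Ω : Set (Space d)} {u : Fin N → Space d → ℝ}
    (hu : IsEigenNFunction Φ Ω u) (i : Fin N) {v : Space d → ℝ} (hv : Integrable v)
    (hv0 : ∀ x, 0 ≤ v x) (hvu : ∀ᵐ x, u i x = 0 → v x = 0) :
    totalVariation (u i) * ∫⁻ x, ENNReal.ofReal (v x) ≤ totalVariation v := by
  obtain ⟨huN, hmin⟩ := hu
  set I := ∫⁻ x, ENNReal.ofReal (v x) with hI
  have hIfin : I ≠ ∞ := by
    rw [hI, ← ofReal_integral_eq_lintegral_ofReal hv (Filter.Eventually.of_forall hv0)]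
    exact ENNReal.ofReal_ne_top
  rcases eq_or_ne I 0 with hI0 | hI0
  · simp [hI0]
  by_contra! hlt
  have hc : 0 < I.toReal := ENNReal.toReal_pos hI0 hIfin
  have hofReal : ENNReal.ofReal I.toReal⁻¹ = I⁻¹ := by
    rw [ENNReal.ofReal_inv_of_pos hc, ENNReal.ofReal_toReal hIfin]
  let w : Space d → ℝ := fun x => I.toReal⁻¹ * v x
  have hw0 : ∀ x, 0 ≤ w x := fun x => mul_nonneg (inv_nonneg.2 hc.le) (hv0 x)
  have hwTV : totalVariation w < totalVariation (u i) := by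
    refine (totalVariation_const_mul_le (inv_nonneg.2 hc.le) v).trans_lt ?_
    rw [hofReal, mul_comm, ← div_eq_mul_inv]
    exact ENNReal.div_lt_of_lt_mul hlt
  have hwu : ∀ᵐ x, u i x = 0 → w x = 0 := by
    filter_upwards [hvu] with x hx h
    simp [w, hx h]
  -- Only the i-th component changes. Since w vanishes where `u i` does, disjointness and the
  -- support condition persist, while one entry of the variation vector strictly drops.
  let u' : Fin N → Space d → ℝ := Function.update u i w
  have hi : u' i = w := Function.update_self ..
  have hne : ∀ j, j ≠ i → u' j = u j := fun j hj => Function.update_of_ne hj ..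
  have hmul : ∀ j, j ≠ i → ∀ᵐ x, x ∈ Ω → w x * u j x = 0 := by
    intro j hj
    filter_upwards [hwu, huN.mul_eq_zero i j hj.symm] with x h1 h2 hx
    rcases mul_eq_zero.1 (h2 hx) with h | h
    · rw [h1 h, zero_mul]
    · rw [h, mul_zero]
  have hu' : IsNFunction Ω u' := by
    refine ⟨fun j => ?_, fun j => ?_, fun j => ?_, fun j k hjk => ?_⟩
    · rcases eq_or_ne j i with rfl | hj
      · rw [hi]
        refine ⟨hv.const_mul _, hwTV.trans (huN.memBVZero j).totalVariation_lt_top, ?_⟩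
        filter_upwards [hwu, (huN.memBVZero j).eq_zero] with x h1 h2 hx
        exact h1 (h2 hx)
      · rw [hne j hj]
        exact huN.memBVZero j
    · rcases eq_or_ne j i with rfl | hj
      · rw [hi]
        exact Filter.Eventually.of_forall fun x _ => hw0 x
      · rw [hne j hj]
        exact huN.nonneg j
    · rcases eq_or_ne j i with rfl | hj
      · rw [hi, eLpNorm_one_eq_lintegral_enorm]
        simp only [Real.enorm_of_nonneg (hw0 _)]
        simp only [w, ENNReal.ofReal_mul (inv_nonneg.2 hc.le)]
        rw [lintegral_const_mul' _ _ ENNReal.ofReal_ne_top, ← hI, hofReal,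
          ENNReal.inv_mul_cancel hI0 hIfin]
      · rw [hne j hj]
        exact huN.norm_eq_one j
    · rcases eq_or_ne j i with rfl | hj
      · rw [hi, hne k hjk.symm]
        exact hmul k hjk.symm
      · rcases eq_or_ne k i with rfl | hk
        · rw [hi, hne j hj]
          simpa only [mul_comm] using hmul j hj
        · rw [hne j hj, hne k hk]
          exact huN.mul_eq_zero j k hjk
  have hfin := (huN.memBVZero i).totalVariation_lt_top.ne
  have hlt' : Φ (variationVec u') < Φ (variationVec u) := by
    refine hΦ _ _ (fun j => ?_) ⟨i, ?_⟩
    · rcases eq_or_ne j i with rfl | hj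
      · simp only [variationVec, hi]
        exact ENNReal.toNNReal_mono hfin hwTV.le
      · simp only [variationVec, hne j hj, le_refl]
    · simp only [variationVec, hi]
      exact (ENNReal.toNNReal_lt_toNNReal hwTV.ne_top hfin).2 hwTV
  have hge : functionalEigenvalue Φ Ω ≤ Φ (variationVec u') := iInf₂_le u' hu'
  rw [← hmin] at hge
  exact absurd hlt' (not_lt.2 (by exact_mod_cast hge))

/-- The essential supremum bound for the components of an eigen-`N`-function, in terms of their
total variation. -/
lemma IsEigenNFunction.eLpNorm_top_le (hd : 1 ≤ d) {Φ : (Fin N → ℝ≥0) → ℝ≥0}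
    (hΦ : IsStrictlyIncreasing Φ) {Ω : Set (Space d)} (hΩ : Bornology.IsBounded Ω)
    {u : Fin N → Space d → ℝ} (hu : IsEigenNFunction Φ Ω u) (i : Fin N) :
    eLpNorm (u i) ∞ volume ≤ (volume (Metric.ball (0 : Space d) 1))⁻¹ *
      (totalVariation (u i) / (d : ℝ≥0∞)) ^ d := by
  have hBV := hu.1.memBVZero i
  have hd0 : (0 : ℝ) < d := by exact_mod_cast hd
  -- A representative of `u i` that is nonnegative everywhere and compactly supported, as the
  -- truncation and isoperimetric lemmas require.
  set w : Space d → ℝ := Ω.indicator fun x => max (u i x) 0 with hw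
  have hwu : w =ᵐ[volume] u i := by
    filter_upwards [hBV.eq_zero, hu.1.nonneg i] with x h1 h2
    by_cases hx : x ∈ Ω
    · simp [hw, hx, h2 hx]
    · simp [hw, hx, h1 hx]
  have hw0 : ∀ x, 0 ≤ w x := fun x => indicator_nonneg (fun _ _ => le_max_right _ _) x
  have hwi : Integrable w := hBV.integrable.congr hwu.symm
  have hwc : HasCompactSupport w :=
    HasCompactSupport.of_support_subset_isCompact hΩ.isCompact_closure
      (support_indicator_subset.trans subset_closure)
  have hw1 : ∫⁻ x, ENNReal.ofReal (w x) = 1 := by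
    rw [← hu.1.norm_eq_one i, ← eLpNorm_congr_ae hwu, eLpNorm_one_eq_lintegral_enorm]
    simp only [Real.enorm_of_nonneg (hw0 _)]
  rw [← eLpNorm_congr_ae hwu, ← totalVariation_congr_ae hwu]
  set lam := totalVariation w with hlam
  have hlamu : totalVariation (u i) = lam := (totalVariation_congr_ae hwu).symm
  have hlamfin : lam ≠ ∞ := hlamu ▸ hBV.totalVariation_lt_top.ne
  set b := volume (Metric.ball (0 : Space d) 1) with hb
  have hb0 : b ≠ 0 := volume_ball_one_pos.ne'
  have hbt : b ≠ ∞ := volume_ball_one_ne_top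
  have hbpos : 0 < b.toReal := ENNReal.toReal_pos hb0 hbt
  set T := b.toReal⁻¹ * (lam.toReal / d) ^ d with hT
  have hT0 : 0 ≤ T := by positivity
  have hRHS : b⁻¹ * (lam / (d : ℝ≥0∞)) ^ d = ENNReal.ofReal T := by
    rw [hT, ENNReal.ofReal_mul (by positivity), ENNReal.ofReal_inv_of_pos hbpos,
      ENNReal.ofReal_toReal hbt, ENNReal.ofReal_pow (by positivity),
      ENNReal.ofReal_div_of_pos hd0, ENNReal.ofReal_toReal hlamfin, ENNReal.ofReal_natCast]
  have key : ∀ t : ℝ, T < t → ∀ᵐ x, w x ≤ t := by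
    intro t htT
    have ht : 0 < t := hT0.trans_lt htT
    let p : Space d → ℝ := fun x => max (w x - t) 0
    let q : Space d → ℝ := fun x => min (w x) t
    have hp0 : ∀ x, 0 ≤ p x := fun x => le_max_right _ _
    have hq0 : ∀ x, 0 ≤ q x := fun x => le_min (hw0 x) ht.le
    have hpi : Integrable p := integrable_posPart_sub hwi hw0 ht.le
    have hqi : Integrable q := integrable_min_const hwi hw0 ht.le
    have hwp : ∀ x, w x = 0 → p x = 0 := fun x hx => by
      simp only [p, hx]
      exact max_eq_right (by linarith)
    have hp1 : lam * ∫⁻ x, ENNReal.ofReal (p x) ≤ totalVariation p := by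
      rw [← hlamu]
      refine hu.mul_lintegral_le hΦ i hpi hp0 ?_
      filter_upwards [hwu] with x hx h
      exact hwp x (hx.trans h)
    have hq1 : lam * ∫⁻ x, ENNReal.ofReal (q x) ≤ totalVariation q := by
      rw [← hlamu]
      refine hu.mul_lintegral_le hΦ i hqi hq0 ?_
      filter_upwards [hwu] with x hx h
      simp [q, hx, h, ht.le]
    have hsum : (∫⁻ x, ENNReal.ofReal (p x)) + ∫⁻ x, ENNReal.ofReal (q x) = 1 := by
      rw [← hw1, ← lintegral_add_left' hpi.aemeasurable.ennreal_ofReal]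
      refine lintegral_congr fun x => ?_
      rw [← ENNReal.ofReal_add (hp0 x) (hq0 x)]
      congr 1
      rcases le_total (w x) t with h | h
      · simp only [p, q, min_eq_left h, max_eq_right (sub_nonpos.2 h), zero_add]
      · simp only [p, q, min_eq_right h, max_eq_left (sub_nonneg.2 h), sub_add_cancel]
    have hpfin : ∫⁻ x, ENNReal.ofReal (p x) ≠ ∞ :=
      ne_top_of_le_ne_top ENNReal.one_ne_top (hsum ▸ le_self_add)
    have hqfin : lam * ∫⁻ x, ENNReal.ofReal (q x) ≠ ∞ :=
      ENNReal.mul_ne_top hlamfin (ne_top_of_le_ne_top ENNReal.one_ne_top (hsum ▸ le_add_self))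
    -- Minimality tested on q, together with |Dp| + |Dq| ≤ λ = λ∫p + λ∫q, leaves no more than λ∫p
    -- for |Dp|.
    have hpTV : totalVariation p ≤ lam * ∫⁻ x, ENNReal.ofReal (p x) := by
      refine (ENNReal.add_le_add_iff_right hqfin).1 ?_
      rw [← mul_add, hsum, mul_one]
      exact (add_le_add_right hq1 _).trans (totalVariation_posPart_add_min_le hwi hwc hw0 ht.le)
    have hzero : ∫⁻ x, ENNReal.ofReal (p x) = 0 := by
      by_contra hne
      -- The radius for which |B_r| = 1/t, Chebyshev's bound for |{w ≥ t}| when ∫ w = 1.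
      set r : ℝ := (1 / (t * b.toReal)) ^ (1 / d : ℝ) with hr
      have hrpos : 0 < r := by positivity
      have hrd : r ^ d = 1 / (t * b.toReal) := by
        rw [hr, ← Real.rpow_natCast, ← Real.rpow_mul (by positivity),
          one_div_mul_cancel hd0.ne', Real.rpow_one]
      have hvol : volume {x | 0 < p x} ≤ volume (Metric.ball (0 : Space d) r) := by
        have h1 : {x | 0 < p x} ⊆ {x | ENNReal.ofReal t ≤ ENNReal.ofReal (w x)} := by
          intro x hx
          refine ENNReal.ofReal_le_ofReal ?_
          by_contra! h
          have h' : p x = 0 := max_eq_right (sub_nonpos.2 h.le)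
          rw [mem_ofPred_eq, h'] at hx
          exact lt_irrefl 0 hx
        have h2 := mul_meas_ge_le_lintegral₀ (μ := volume) hwi.aemeasurable.ennreal_ofReal
          (ENNReal.ofReal t)
        rw [hw1] at h2
        rw [volume_ball_eq hd hrpos.le, hrd]
        have h3 : ENNReal.ofReal (1 / (t * b.toReal)) * b = (ENNReal.ofReal t)⁻¹ := by
          rw [one_div, mul_inv, ENNReal.ofReal_mul (by positivity),
            ENNReal.ofReal_inv_of_pos ht, ENNReal.ofReal_inv_of_pos hbpos,
            ENNReal.ofReal_toReal hbt, mul_assoc, ENNReal.inv_mul_cancel hb0 hbt, mul_one]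
        rw [← hb, h3]
        refine (measure_mono h1).trans ?_
        rw [← one_div, ENNReal.le_div_iff_mul_le (Or.inl (by simpa using ht))
          (Or.inl ENNReal.ofReal_ne_top), mul_comm]
        exact h2
      have hpc : HasCompactSupport p := hwc.mono fun x hx h => hx (hwp x h)
      have hiso := (mul_lintegral_le_totalVariation hd hpi hpc hp0 hrpos hvol).trans hpTV
      -- Cancelling ∫ p, which is nonzero and finite, gives d/r ≤ λ. Its d-th power reads t ≤ T,
      -- contradicting the choice of t.
      have hle : ENNReal.ofReal (d / r) ≤ lam := (ENNReal.mul_le_mul_iff_left hne hpfin).1 hiso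
      rw [ENNReal.ofReal_le_iff_le_toReal hlamfin, div_le_iff₀ hrpos] at hle
      have h4 : (d : ℝ) ^ d ≤ lam.toReal ^ d * (1 / (t * b.toReal)) := by
        rw [← hrd, ← mul_pow]
        gcongr
      have h5 : t ≤ T := by
        rw [hT, div_pow, inv_mul_eq_div, div_div, le_div_iff₀ (by positivity)]
        rw [mul_one_div, le_div_iff₀ (by positivity)] at h4
        linarith
      exact absurd htT (not_lt.2 h5)
    rw [lintegral_eq_zero_iff' hpi.aemeasurable.ennreal_ofReal] at hzero
    filter_upwards [hzero] with x hx
    have h1 : p x ≤ 0 := ENNReal.ofReal_eq_zero.1 hx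
    linarith [le_max_left (w x - t) 0]
  have hbound : ∀ t : ℝ, T < t → eLpNorm w ∞ volume ≤ ENNReal.ofReal t := by
    intro t ht
    rw [eLpNorm_exponent_top]
    refine eLpNormEssSup_le_of_ae_bound ?_
    filter_upwards [key t ht] with x hx
    rwa [Real.norm_of_nonneg (hw0 x)]
  rw [hRHS]
  exact ge_of_tendsto ((ENNReal.continuous_ofReal.tendsto T).mono_left nhdsWithin_le_nhds)
    (eventually_mem_nhdsWithin.mono hbound : ∀ᶠ t in 𝓝[>] T, _)

end EigenFunctions

end CheegerCluster

/-! ### From total variation to the Cheeger constant. -/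

theorem mainTheorem11 {d N : ℕ} (hd : 1 ≤ d)
    (Ω : Set (CheegerCluster.Space d))
    (hΩne : Ω.Nonempty) (hΩb : Bornology.IsBounded Ω) (hΩo : IsOpen Ω)
    (Φ : (Fin N → ℝ≥0) → ℝ≥0) (δ : ℝ)
    (hΦc : CheegerCluster.IsCoerciveWith Φ δ)
    (hΦs : CheegerCluster.IsStrictlyIncreasing Φ)
    (u : Fin N → CheegerCluster.Space d → ℝ)
    (hu : CheegerCluster.IsEigenNFunction Φ Ω u) :
    MemLp (fun x i => u i x) ∞ (volume.restrict Ω) ∧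
    ∀ i, eLpNorm (u i) ∞ (volume.restrict Ω) ≤
      (volume (Metric.ball (0 : CheegerCluster.Space d) 1))⁻¹ *
        (CheegerCluster.cheegerConst Φ Ω / (ENNReal.ofReal δ * (d : ℝ≥0∞))) ^ d := by
  have hd0 : (d : ℝ≥0∞) ≠ 0 := by exact_mod_cast (by omega : d ≠ 0)
  have hbound : ∀ i, eLpNorm (u i) ∞ (volume.restrict Ω) ≤
      (volume (Metric.ball (0 : CheegerCluster.Space d) 1))⁻¹ *
        (CheegerCluster.totalVariation (u i) / (d : ℝ≥0∞)) ^ d := fun i =>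
    (eLpNorm_mono_measure _ Measure.restrict_le_self).trans
      (hu.eLpNorm_top_le hd hΦs hΩb i)
  refine ⟨?_, fun i => (hbound i).trans ?_⟩
  · refine memLp_pi_iff.2 fun i => ⟨?_, (hbound i).trans_lt ?_⟩
    · exact (hu.1.memBVZero i).integrable.aestronglyMeasurable.restrict
    · refine ENNReal.mul_lt_top ?_ (ENNReal.pow_lt_top (ENNReal.div_lt_top
        (hu.1.memBVZero i).totalVariation_lt_top.ne hd0))
      exact ENNReal.inv_lt_top.2 CheegerCluster.volume_ball_one_pos
  · gcongr _ * ?_ ^ d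
    have hfin := (hu.1.memBVZero i).totalVariation_lt_top.ne
    -- One variation is at most the sum of all; coercivity bounds δ times that sum by the
    -- eigenvalue, and the eigenvalue is at most the Cheeger constant.
    have h1 : ENNReal.ofReal δ * CheegerCluster.totalVariation (u i) ≤
        CheegerCluster.cheegerConst Φ Ω := by
      refine le_trans ?_ (CheegerCluster.functionalEigenvalue_le_cheegerConst hΦs hΩb)
      rw [← hu.2, ← ENNReal.ofReal_toReal hfin, ← ENNReal.ofReal_mul hΦc.1.le,
        ← ENNReal.ofReal_coe_nnreal]
      refine ENNReal.ofReal_le_ofReal (le_trans ?_ (hΦc.2 _))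
      refine mul_le_mul_of_nonneg_left ?_ hΦc.1.le
      exact Finset.single_le_sum (f := fun i =>
        ((CheegerCluster.variationVec u i : ℝ≥0) : ℝ)) (fun j _ => NNReal.coe_nonneg _)
        (Finset.mem_univ i)
    have hδ : ENNReal.ofReal δ ≠ 0 := by simpa using hΦc.1
    rw [ENNReal.le_div_iff_mul_le
      (Or.inl (mul_ne_zero hδ hd0))
      (Or.inl (ENNReal.mul_ne_top ENNReal.ofReal_ne_top (ENNReal.natCast_ne_top d))),
      mul_comm (ENNReal.ofReal δ), ← mul_assoc,
      ENNReal.div_mul_cancel hd0 (ENNReal.natCast_ne_top d), mul_comm]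
    exact h1
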